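/- Let $p\ge 3$ be a prime, $R_0\ge 3$ an integer, $\alpha>0$ and $m_\alpha>0$ real. Let $dx$ be the Haar measure of $\mathbb{Q}_p$ with $\int_{\mathbb{Z}_p}dx=1$, let $\chi_p(x)=e^{2\pi i\{x\}_p}$ where $\{x\}_p$ is the $p$-adic fractional part, and let $\mathcal F$ be the Fourier transform on $L^2(\mathbb{Q}_p)$, $(\mathcal Ff)(\xi)=\lim_{n\to\infty}\int_{|x|_p\le p^n}\chi_p(\xi x)f(x)\,dx$ (limit in $L^2$). Let $\boldsymbol D^\alpha f=\mathcal F^{-1}(|\xi|_p^\alpha\,\mathcal Ff)$, with domain $\{f\in L^2(\mathbb{Q}_p):|\xi|_p^\alpha\mathcal Ff\in L^2(\mathbb{Q}_p)\}$, and let $\boldsymbol H\Phi=m_\alpha 1_{\mathbb{Z}_p}\boldsymbol D^\alpha\Phi$ on $\mathrm{Dom}(\boldsymbol D^\alpha)\cap L^2(\mathbb{Z}_p)$, where $L^2(\mathbb{Z}_p)$ is the space of functions in $L^2(\mathbb{Q}_p)$ vanishing outside $\mathbb{Z}_p$. The vertices of the complete graph $K_{R_0}$ are $0,1,\dots,R_0-1$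 and $\Gamma$. To the vertex $j$ we attach the sphere $\mathcal K_j=S_{-j}=\{x:|x|_p=p^{-j}\}$, and to $\Gamma$ the ball $\mathcal K_\Gamma=p^{R_0}\mathbb{Z}_p$. For a vertex $v$ let $\Psi_v(\cdot,t)=e^{-i\boldsymbol Ht}(c_v1_{\mathcal K_v})$, $t\ge 0$, where $c_v>0$ is such that $\|c_v1_{\mathcal K_v}\|_2=1$; that is, $\Psi_v$ is the solution, continuous on $[0,\infty)$ with values in $L^2(\mathbb{Z}_p)$ and differentiable for $t>0$, of the Cauchy problem $i\,\partial_t\Psi_v=\boldsymbol H\Psi_v$ for $t>0$, $\Psi_v(\cdot,0)=c_v1_{\mathcal K_v}$. The transition probability from $v$ to $w$ is $\pi_{w,v}(t)=\int_{\mathcal K_w}|\Psi_v(x,t)|^2\,dx$. Put $E_{gnd}=m_\alpha\frac{1-p^{-1}}{1-p^{-\alpha-1}}$ and $E_m=m_\alpha p^{(1+m)\alpha}$ for $m\ge 0$. For $r\ge0$ put $C_0^{(r)}=p^{-r}(1-p^{-1})$, and $C_m^{(r)}=p^{\frac m2-r}(1-p^{-1})$ if $m\le r-1$, $C_r^{(r)}=-p^{-\frac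 r2-1}$, $C_m^{(r)}=0$ if $m>r$. Theorem. For every vertex $v$ the Cauchy problem has a unique solution $\Psi_v$, and for all $t\ge 0$ and all $r\in\{0,\dots,R_0-1\}$: $$\pi_{\Gamma,\Gamma}(t)=p^{-2R_0}\Big|e^{-iE_{gnd}t}+(p-1)\sum_{m=0}^{R_0-1}p^me^{-iE_mt}\Big|^2,$$ $$\pi_{r,\Gamma}(t)=p^{-r-R_0}\int_{S_0}\Big|e^{-iE_{gnd}t}+\sum_{k=1}^{p-1}\ \sum_{m=0}^{\min\{r,R_0-1\}}p^me^{-iE_mt}\chi_p(p^{-m-1+r}ku)\Big|^2du,$$ $$\pi_{\Gamma,r}(t)=p^{r-R_0}(1-p^{-1})^{-1}\Big|C_0^{(r)}e^{-iE_{gnd}t}+\sum_{k=1}^{p-1}\ \sum_{m=0}^{\min\{r,R_0-1\}}C_m^{(r)}e^{-iE_mt}p^{\frac m2}\Big|^2.$$ -/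

import Mathlib

open MeasureTheory Filter Topology

namespace PadicWalk

noncomputable section

/-! ### Haar measure and the additive character of `ℚ_p` -/

instance instMeasurableSpacePadic (p : ℕ) [Fact p.Prime] : MeasurableSpace ℚ_[p] := borel ℚ_[p]

instance instBorelSpacePadic (p : ℕ) [Fact p.Prime] : BorelSpace ℚ_[p] := ⟨rfl⟩

/-- The unit ball `ℤ_p = {x : |x|_p ≤ 1}` as a compact set with nonempty interior. -/
def unitBallCompacts (p : ℕ) [Fact p.Prime] : TopologicalSpace.PositiveCompacts ℚ_[p] where
  carrier := Metric.closedBall 0 1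
  isCompact' := isCompact_closedBall 0 1
  interior_nonempty' :=
    ⟨0, Metric.ball_subset_interior_closedBall (Metric.mem_ball_self one_pos)⟩

/-- The Haar measure `dx` of `(ℚ_p, +)`, normalized so that `ℤ_p` has measure one. -/
def haar (p : ℕ) [Fact p.Prime] : Measure ℚ_[p] :=
  Measure.addHaarMeasure (unitBallCompacts p)

theorem haar_unitBall (p : ℕ) [Fact p.Prime] : haar p (Metric.closedBall 0 1) = 1 :=
  Measure.addHaarMeasure_self

/-- Multiplying `x` by `p ^ n`, with `n = max (-ord x) 0`, gives a `p`-adic integer. -/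
theorem norm_mul_pow_le_one {p : ℕ} [Fact p.Prime] (x : ℚ_[p]) :
    ‖x * (p : ℚ_[p]) ^ (-x.valuation).toNat‖ ≤ 1 := by
  by_cases hx : x = 0
  · simp [hx]
  · have hp : (1 : ℝ) < p := by exact_mod_cast (Fact.out : p.Prime).one_lt
    rw [norm_mul, norm_pow, Padic.norm_p, Padic.norm_eq_zpow_neg_valuation hx, inv_pow,
      ← zpow_natCast, ← zpow_neg, ← zpow_add₀ (by positivity)]
    exact zpow_le_one_of_nonpos₀ hp.le (by have := Int.self_le_toNat (-x.valuation); omega)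

/-- The fractional part `{x}_p`. Writing `n = max (-ord x) 0`, it is `a / p ^ n`, where
`a ∈ {0, …, p ^ n - 1}` is the residue of the `p`-adic integer `p ^ n x` modulo `p ^ n`, that is,
the sum of the first `n` terms of its digit expansion. -/
def fractPart {p : ℕ} [Fact p.Prime] (x : ℚ_[p]) : ℝ :=
  (PadicInt.appr ⟨x * (p : ℚ_[p]) ^ (-x.valuation).toNat, norm_mul_pow_le_one x⟩
      (-x.valuation).toNat : ℝ) / (p : ℝ) ^ (-x.valuation).toNat

/-- The additive character `χ_p(x) = exp(2πi {x}_p)`. -/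
def chi {p : ℕ} [Fact p.Prime] (x : ℚ_[p]) : ℂ :=
  Complex.exp (2 * Real.pi * Complex.I * (fractPart x : ℂ))

/-! ### The Fourier transform on `L²(ℚ_p)` and the Taibleson-Vladimirov operator -/

/-- The complex Hilbert space `L²(ℚ_p, dx)`. -/
abbrev L2 (p : ℕ) [Fact p.Prime] : Type := Lp ℂ 2 (haar p)

/-- The truncated Fourier integral `ξ ↦ ∫_{|x|_p ≤ p^n} χ_p(ξ x) f(x) dx`. -/
def fourierTrunc {p : ℕ} [Fact p.Prime] (f : ℚ_[p] → ℂ) (n : ℕ) (ξ : ℚ_[p]) : ℂ :=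
  ∫ x in Metric.closedBall (0 : ℚ_[p]) ((p : ℝ) ^ n), chi (ξ * x) * f x ∂(haar p)

/-- `g = 𝓕 f`: the truncated Fourier integrals of `f` converge to `g` in `L²(ℚ_p)`. -/
def IsFourier {p : ℕ} [Fact p.Prime] (f g : L2 p) : Prop :=
  Tendsto (fun n : ℕ => eLpNorm (fun ξ => fourierTrunc f n ξ - g ξ) 2 (haar p)) atTop (𝓝 0)

/-- `h = 𝓕⁻¹ k`: the integrals `x ↦ ∫_{|ξ|_p ≤ p^n} χ_p(-ξ x) k(ξ) dξ` converge to `h`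
in `L²(ℚ_p)`. -/
def IsInvFourier {p : ℕ} [Fact p.Prime] (k h : L2 p) : Prop :=
  Tendsto (fun n : ℕ => eLpNorm (fun x => fourierTrunc k n (-x) - h x) 2 (haar p)) atTop (𝓝 0)

/-- `f ∈ Dom(D^α)` and `h = D^α f`: with `g = 𝓕 f`, the function `k = |ξ|_p^α g` is in `L²(ℚ_p)`
and `h = 𝓕⁻¹ k`. -/
def IsTaibleson {p : ℕ} [Fact p.Prime] (α : ℝ) (f h : L2 p) : Prop :=
  ∃ g k : L2 p, IsFourier f g ∧
    (k =ᵐ[haar p] fun ξ => ((‖ξ‖ ^ α : ℝ) : ℂ) * g ξ) ∧ IsInvFourier k h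

/-! ### The Hamiltonian of the infinite well and its time evolution

The space `L²(ℤ_p)` is the space of the elements of `L²(ℚ_p)` that vanish outside `ℤ_p`. -/

/-- `Φ ∈ Dom(H) = Dom(D^α) ∩ L²(ℤ_p)` and `η = H Φ`, where
`H Φ = m_α Ω(|x|_p) D^α Φ` and `Ω(|x|_p)` is the characteristic function of `ℤ_p`. -/
def IsHamiltonian {p : ℕ} [Fact p.Prime] (α mα : ℝ) (Φ η : L2 p) : Prop :=
  (∀ᵐ x ∂(haar p), x ∉ Metric.closedBall (0 : ℚ_[p]) 1 → Φ x = 0) ∧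
    ∃ h : L2 p, IsTaibleson α Φ h ∧
      η =ᵐ[haar p] (Metric.closedBall (0 : ℚ_[p]) 1).indicator fun x => (mα : ℂ) * h x

/-- `Ψ(·, t) = e^{-iHt} (c 1_K)`, `t ≥ 0`, where `c > 0` is such that `‖c 1_K‖₂ = 1`: the solution
of the Cauchy problem `i ∂Ψ/∂t = H Ψ` for `t > 0`, `Ψ(·, 0) = c 1_K`, in `L²(ℤ_p)`. -/
structure IsWaveFunction {p : ℕ} [Fact p.Prime] (α mα : ℝ) (K : Set ℚ_[p]) (Ψ : ℝ → L2 p) :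
    Prop where
  initial : Ψ 0 =ᵐ[haar p] K.indicator fun _ => (((Real.sqrt ((haar p).real K))⁻¹ : ℝ) : ℂ)
  continuousOn : ContinuousOn Ψ (Set.Ici 0)
  schrodinger : ∀ t : ℝ, 0 < t →
    ∃ Ψ' : L2 p, HasDerivAt Ψ Ψ' t ∧ IsHamiltonian α mα (Ψ t) (Complex.I • Ψ')

/-- The probability `∫_K |Ψ(x, t)|² dx` of finding the walker in `K` at time `t`. -/
def transitionProb {p : ℕ} [Fact p.Prime] (K : Set ℚ_[p]) (Ψ : ℝ → L2 p) (t : ℝ) : ℝ :=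
  ∫ x in K, ‖Ψ t x‖ ^ 2 ∂(haar p)

/-! ### The vertices of `K_{R₀}` -/

/-- The vertices of the complete graph `K_{R₀}`: `0, 1, …, R₀ - 1` and `Γ`. -/
inductive Vertex (R₀ : ℕ) : Type
  | sphere (j : Fin R₀) : Vertex R₀
  | gamma : Vertex R₀

/-- The subset of `ℤ_p` attached to a vertex: the sphere `S_{-j} = {x : |x|_p = p^{-j}}` for the
vertex `j`, and the ball `p^{R₀} ℤ_p = {x : |x|_p ≤ p^{-R₀}}` for `Γ`. -/
def cell (p : ℕ) [Fact p.Prime] {R₀ : ℕ} : Vertex R₀ → Set ℚ_[p]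
  | .sphere j => {x | ‖x‖ = (p : ℝ) ^ (-((j : ℕ) : ℤ))}
  | .gamma => {x | ‖x‖ ≤ (p : ℝ) ^ (-(R₀ : ℤ))}

/-! ### Energies and Fourier coefficients -/

/-- `E_gnd = m_α (1 - p^{-1}) / (1 - p^{-α-1})`. -/
def energyGnd (p : ℕ) (α mα : ℝ) : ℝ :=
  mα * ((1 - (p : ℝ)⁻¹) / (1 - (p : ℝ) ^ (-α - 1)))

/-- `E_m = m_α p^{(1+m)α}`. -/
def energy (p : ℕ) (α mα : ℝ) (m : ℕ) : ℝ :=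
  mα * (p : ℝ) ^ ((1 + (m : ℝ)) * α)

/-- The coefficient `C_0 = p^{-j} (1 - p^{-1})` of `1_{S_{-j}}`. -/
def coeffZero (p j : ℕ) : ℝ :=
  (p : ℝ) ^ (-(j : ℝ)) * (1 - (p : ℝ)⁻¹)

/-- The coefficient `C_{(-m)0k}` of `1_{S_{-j}}`, which is the same for all `k`. -/
def coeff (p j m : ℕ) : ℝ :=
  if j < m then 0
  else if m = j then -(p : ℝ) ^ (-(j : ℝ) / 2 - 1)
  else (p : ℝ) ^ ((m : ℝ) / 2 - j) * (1 - (p : ℝ)⁻¹)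

/-- The phase `e^{-iEt}`. -/
def phase (E t : ℝ) : ℂ :=
  Complex.exp (-Complex.I * E * t)

end

end PadicWalk

namespace PadicWalk

noncomputable section

variable {p : ℕ} [Fact p.Prime]

/-! Every initial state is a finite combination of radial eigenfunctions of `H`: the indicator of
`ℤ_p` and `w_m = p 1_{p^{m+1}ℤ_p} - 1_{p^m ℤ_p}`. The Fourier transform of `w_m` lives on the single
sphere `|ξ| = p^{m+1}`, where `|ξ|^α` is constant, so `w_m` has eigenvalue `E_m`
(`exactHamiltonian_waveletLp`). The transform of `1_{ℤ_p}` meets infinitely many spheres; after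
cutting back to `ℤ_p` the resulting series is constant, a geometric sum giving `E_gnd`
(`exactHamiltonian_ballLp_zero`).

The telescoping identity `1_{ℤ_p} + ∑_{m<N} p^m w_m = p^N 1_{p^N ℤ_p}` (`sum_pow_mul_eigenFun`)
expands balls, hence spheres, in these eigenfunctions, and attaching phases solves the Cauchy
problem. Any other solution agrees with this one because `H` is symmetric
(`IsHamiltonian.inner_comm`), so the norm of the difference of two solutions is conserved.

The probabilities needed are then read off from the constant values `p - 1`, `-1`, `0` of `w_m` on
the cells. The character sums over `k` in the statement take these same values (`sum_chi_zpow_mul`).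
-/

theorem one_lt_prime_real (p : ℕ) [Fact p.Prime] : (1 : ℝ) < p := by
  exact_mod_cast (Fact.out : p.Prime).one_lt

theorem prime_real_pos (p : ℕ) [Fact p.Prime] : (0 : ℝ) < p :=
  zero_lt_one.trans (one_lt_prime_real p)

instance instIsAddHaarMeasureHaar (p : ℕ) [Fact p.Prime] : (haar p).IsAddHaarMeasure :=
  inferInstanceAs (Measure.addHaarMeasure (unitBallCompacts p)).IsAddHaarMeasure

/-! ### The additive character -/

theorem norm_sub_le_max (x y : ℚ_[p]) : ‖x - y‖ ≤ max ‖x‖ ‖y‖ := by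
  rw [sub_eq_add_neg, ← norm_neg y]
  exact IsUltrametricDist.norm_add_le_max _ _

theorem norm_sub_fractPart (x : ℚ_[p]) :
    ∃ a n : ℕ, a < p ^ n ∧ fractPart x = (a : ℝ) / (p : ℝ) ^ n ∧
      ‖x - (a : ℚ_[p]) / (p : ℚ_[p]) ^ n‖ ≤ 1 := by
  set n := (-x.valuation).toNat with hn
  let y : ℤ_[p] := ⟨x * (p : ℚ_[p]) ^ n, norm_mul_pow_le_one x⟩
  refine ⟨y.appr n, n, PadicInt.appr_lt y n, rfl, ?_⟩
  have h1 : ‖y - (y.appr n : ℤ_[p])‖ ≤ (p : ℝ) ^ (-n : ℤ) :=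
    (PadicInt.norm_le_pow_iff_mem_span_pow _ _).2 (PadicInt.appr_spec n y)
  have hp0 : (p : ℚ_[p]) ≠ 0 := by exact_mod_cast (Fact.out : p.Prime).ne_zero
  have h2 : x - (y.appr n : ℚ_[p]) / (p : ℚ_[p]) ^ n
      = ((y - (y.appr n : ℤ_[p]) : ℤ_[p]) : ℚ_[p]) / (p : ℚ_[p]) ^ n := by
    push_cast
    field_simp
    rfl
  have hpr := prime_real_pos p
  rw [h2, norm_div, norm_pow, Padic.norm_p, ← PadicInt.norm_def, div_le_one (by positivity)]
  rwa [inv_pow, ← zpow_natCast, ← zpow_neg]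

theorem exp_eq_one_of_norm_le_one (z : ℤ) (n : ℕ) (h : ‖(z : ℚ_[p]) / (p : ℚ_[p]) ^ n‖ ≤ 1) :
    Complex.exp (2 * Real.pi * Complex.I * ((z : ℂ) / (p : ℂ) ^ n)) = 1 := by
  have hpr := prime_real_pos p
  rw [norm_div, norm_pow, Padic.norm_p, div_le_one (by positivity), inv_pow, ← zpow_natCast,
    ← zpow_neg, Padic.norm_int_le_pow_iff_dvd] at h
  obtain ⟨w, rfl⟩ := h
  have hpc : (p : ℂ) ≠ 0 := by exact_mod_cast (Fact.out : p.Prime).ne_zero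
  rw [Complex.exp_eq_one_iff]
  refine ⟨w, ?_⟩
  push_cast
  field_simp

/-- Two representatives of `x` modulo `ℤ_p` with `p`-power denominators differ by an element of
`ℤ[1/p] ∩ ℤ_p = ℤ`, invisible to the exponential. Freedom in the representative makes additivity
immediate, with no carries to track. -/
theorem chi_eq_exp (x : ℚ_[p]) (z : ℤ) (n : ℕ) (h : ‖x - (z : ℚ_[p]) / (p : ℚ_[p]) ^ n‖ ≤ 1) :
    chi x = Complex.exp (2 * Real.pi * Complex.I * ((z : ℂ) / (p : ℂ) ^ n)) := by
  obtain ⟨a, m, -, hf, ha⟩ := norm_sub_fractPart x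
  have hp0 : (p : ℚ_[p]) ≠ 0 := by exact_mod_cast (Fact.out : p.Prime).ne_zero
  have hpc : (p : ℂ) ≠ 0 := by exact_mod_cast (Fact.out : p.Prime).ne_zero
  have h1 : ‖((a * p ^ n - z * p ^ m : ℤ) : ℚ_[p]) / (p : ℚ_[p]) ^ (m + n)‖ ≤ 1 := by
    have : ((a * p ^ n - z * p ^ m : ℤ) : ℚ_[p]) / (p : ℚ_[p]) ^ (m + n)
        = (x - (z : ℚ_[p]) / (p : ℚ_[p]) ^ n) - (x - (a : ℚ_[p]) / (p : ℚ_[p]) ^ m) := by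
      push_cast
      field_simp
      ring
    rw [this]
    refine (norm_sub_le_max _ _).trans (max_le h ha)
  have h2 := exp_eq_one_of_norm_le_one _ _ h1
  have h3 : (2 * Real.pi * Complex.I * (((a : ℝ) / (p : ℝ) ^ m : ℝ) : ℂ))
      = 2 * Real.pi * Complex.I * (((a * p ^ n - z * p ^ m : ℤ) : ℂ) / (p : ℂ) ^ (m + n))
        + 2 * Real.pi * Complex.I * ((z : ℂ) / (p : ℂ) ^ n) := by
    push_cast
    field_simp
    ring
  rw [chi, hf, h3, Complex.exp_add, h2, one_mul]

theorem chi_eq_one {x : ℚ_[p]} (h : ‖x‖ ≤ 1) : chi x = 1 := by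
  rw [chi_eq_exp x 0 0 (by simpa using h)]
  simp

theorem chi_add (x y : ℚ_[p]) : chi (x + y) = chi x * chi y := by
  obtain ⟨a, m, -, -, ha⟩ := norm_sub_fractPart x
  obtain ⟨b, n, -, -, hb⟩ := norm_sub_fractPart y
  have hp0 : (p : ℚ_[p]) ≠ 0 := by exact_mod_cast (Fact.out : p.Prime).ne_zero
  have hpc : (p : ℂ) ≠ 0 := by exact_mod_cast (Fact.out : p.Prime).ne_zero
  rw [chi_eq_exp x a m (by rwa [Int.cast_natCast]), chi_eq_exp y b n (by rwa [Int.cast_natCast]),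
    chi_eq_exp (x + y) (a * p ^ n + b * p ^ m) (m + n), ← Complex.exp_add]
  · congr 1
    push_cast
    field_simp
    ring
  · have : x + y - ((a * p ^ n + b * p ^ m : ℤ) : ℚ_[p]) / (p : ℚ_[p]) ^ (m + n)
        = (x - (a : ℚ_[p]) / (p : ℚ_[p]) ^ m) + (y - (b : ℚ_[p]) / (p : ℚ_[p]) ^ n) := by
      push_cast
      field_simp
      ring
    rw [this]
    exact (IsUltrametricDist.norm_add_le_max _ _).trans (max_le ha hb)

/-- The fractional part is then an integer in `[0, 1)`, so its numerator is zero. -/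
theorem norm_le_one_of_chi_eq_one {x : ℚ_[p]} (h : chi x = 1) : ‖x‖ ≤ 1 := by
  obtain ⟨a, n, hlt, hf, ha⟩ := norm_sub_fractPart x
  have hpr := prime_real_pos p
  rw [chi, Complex.exp_eq_one_iff] at h
  obtain ⟨w, hw⟩ := h
  have h1 : fractPart x = w := by
    have : (fractPart x : ℂ) = w := by
      have h2 := Complex.two_pi_I_ne_zero
      apply mul_left_cancel₀ h2
      rw [hw]
      ring
    exact_mod_cast this
  have h2 : (a : ℝ) / (p : ℝ) ^ n < 1 := by
    rw [div_lt_one (by positivity)]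
    exact_mod_cast hlt
  have h3 : (0 : ℝ) ≤ (a : ℝ) / (p : ℝ) ^ n := by positivity
  rw [← hf, h1] at h2 h3
  have hw0 : w = 0 := by
    have : w < 1 := by exact_mod_cast h2
    have : 0 ≤ w := by exact_mod_cast h3
    omega
  have ha0 : (a : ℝ) = 0 := by
    rw [hw0, Int.cast_zero, hf, div_eq_zero_iff] at h1
    exact h1.resolve_right (by positivity)
  have : a = 0 := by exact_mod_cast ha0
  simpa [this] using ha

theorem norm_chi (x : ℚ_[p]) : ‖chi x‖ = 1 := by
  have : 2 * Real.pi * Complex.I * (fractPart x : ℂ)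
      = ((2 * Real.pi * fractPart x : ℝ) : ℂ) * Complex.I := by
    push_cast
    ring
  rw [chi, this, Complex.norm_exp_ofReal_mul_I]

theorem chi_neg (x : ℚ_[p]) : chi (-x) = (starRingEnd ℂ) (chi x) := by
  have h : chi (-x) * chi x = 1 := by
    rw [← chi_add, neg_add_cancel, chi_eq_one (by simp)]
  have hn : (starRingEnd ℂ) (chi x) * chi x = 1 := by
    rw [mul_comm, Complex.mul_conj, Complex.normSq_eq_norm_sq, norm_chi]
    simp
  have h0 : chi x ≠ 0 := by
    rw [← norm_ne_zero_iff, norm_chi]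
    exact one_ne_zero
  exact mul_right_cancel₀ h0 (h.trans hn.symm)

theorem chi_natCast_mul (k : ℕ) (x : ℚ_[p]) : chi ((k : ℚ_[p]) * x) = chi x ^ k := by
  induction k with
  | zero => simp [chi_eq_one]
  | succ k ih => rw [Nat.cast_succ, add_mul, chi_add, ih, one_mul, pow_succ]

/-- The character is locally constant, being trivial on the unit ball. -/
theorem continuous_chi : Continuous (chi : ℚ_[p] → ℂ) := by
  rw [continuous_iff_continuousAt]
  intro x
  apply ContinuousAt.congr (continuousAt_const (y := chi x))
  filter_upwards [Metric.ball_mem_nhds x one_pos] with y hy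
  have : chi (y - x) = 1 := chi_eq_one (by rw [← dist_eq_norm]; exact (Metric.mem_ball.1 hy).le)
  rw [← sub_add_cancel y x, chi_add, this, one_mul]

/-- Here `chi x` is a nontrivial `p`-th root of unity, so the sum over all residues vanishes; the
missing term `k = 0` is `1`. -/
theorem sum_chi_mul {x : ℚ_[p]} (h : ‖x‖ = p) : ∑ k ∈ Finset.Ico 1 p, chi ((k : ℚ_[p]) * x) = -1 := by
  have hp1 := one_lt_prime_real p
  have hne : chi x ≠ 1 := fun h1 => by
    have := norm_le_one_of_chi_eq_one h1
    linarith
  have hpow : chi x ^ p = 1 := by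
    rw [← chi_natCast_mul, chi_eq_one]
    rw [norm_mul, Padic.norm_p, h, inv_mul_cancel₀ (by positivity)]
  have hg := geom_sum_eq hne p
  rw [hpow, sub_self, zero_div, Finset.range_eq_Ico,
    Finset.sum_eq_sum_Ico_succ_bot (Fact.out : p.Prime).pos] at hg
  simp only [chi_natCast_mul]
  simp only [pow_zero, zero_add] at hg
  linear_combination hg

/-! ### Balls -/

/-- The ball `{x : |x|_p ≤ p ^ n}`. -/
def pball (p : ℕ) [Fact p.Prime] (n : ℤ) : Set ℚ_[p] := Metric.closedBall 0 ((p : ℝ) ^ n)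

theorem mem_pball {n : ℤ} {x : ℚ_[p]} : x ∈ pball p n ↔ ‖x‖ ≤ (p : ℝ) ^ n := by
  simp [pball]

theorem pball_zero : pball p 0 = Metric.closedBall 0 1 := by simp [pball]

theorem measurableSet_pball (n : ℤ) : MeasurableSet (pball p n) :=
  Metric.isClosed_closedBall.measurableSet

theorem isCompact_pball (n : ℤ) : IsCompact (pball p n) := isCompact_closedBall _ _

theorem pball_mono {m n : ℤ} (h : m ≤ n) : pball p m ⊆ pball p n :=
  Metric.closedBall_subset_closedBall (zpow_le_zpow_right₀ (one_lt_prime_real p).le h)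

theorem haar_pball_ne_top (n : ℤ) : haar p (pball p n) ≠ ⊤ := (isCompact_pball n).measure_ne_top

theorem norm_prime_zpow (n : ℤ) : ‖(p : ℚ_[p]) ^ n‖ = (p : ℝ) ^ (-n) := by
  rw [norm_zpow, Padic.norm_p, inv_zpow', zpow_neg]

/-- Points of the larger ball are sorted by their leading `p`-adic digit. -/
theorem pball_eq_iUnion (n : ℤ) :
    pball p (n + 1) = ⋃ i ∈ Finset.range p,
      Metric.closedBall ((i : ℚ_[p]) * (p : ℚ_[p]) ^ (-(n + 1))) ((p : ℝ) ^ n) := by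
  have hp0 : (p : ℚ_[p]) ≠ 0 := by exact_mod_cast (Fact.out : p.Prime).ne_zero
  have hpr := prime_real_pos p
  ext x
  simp only [Set.mem_iUnion, Finset.mem_range, exists_prop, mem_closedBall_iff_norm, mem_pball]
  constructor
  · intro hx
    have hy : ‖x * (p : ℚ_[p]) ^ (n + 1)‖ ≤ 1 := by
      rw [norm_mul, norm_prime_zpow, zpow_neg, ← div_eq_mul_inv, div_le_one (by positivity)]
      exact hx
    let y : ℤ_[p] := ⟨_, hy⟩
    refine ⟨y.appr 1, by simpa using PadicInt.appr_lt y 1, ?_⟩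
    have h1 : ‖y - (y.appr 1 : ℤ_[p])‖ ≤ (p : ℝ) ^ (-(1 : ℕ) : ℤ) :=
      (PadicInt.norm_le_pow_iff_mem_span_pow _ _).2 (PadicInt.appr_spec 1 y)
    have h2 : x - (y.appr 1 : ℚ_[p]) * (p : ℚ_[p]) ^ (-(n + 1))
        = ((y - (y.appr 1 : ℤ_[p]) : ℤ_[p]) : ℚ_[p]) * (p : ℚ_[p]) ^ (-(n + 1)) := by
      have h3 : ((y : ℤ_[p]) : ℚ_[p]) = x * (p : ℚ_[p]) ^ (n + 1) := rfl
      push_cast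
      rw [h3, sub_mul, mul_assoc, ← zpow_add₀ hp0]
      simp
    rw [h2, norm_mul, norm_prime_zpow, ← PadicInt.norm_def, neg_neg]
    calc _ ≤ (p : ℝ) ^ (-(1 : ℕ) : ℤ) * (p : ℝ) ^ (n + 1) := by gcongr
      _ = (p : ℝ) ^ n := by
        rw [← zpow_add₀ hpr.ne']
        congr 1
        push_cast
        ring
  · rintro ⟨i, -, hi⟩
    rw [← sub_add_cancel x ((i : ℚ_[p]) * (p : ℚ_[p]) ^ (-(n + 1)))]
    refine (IsUltrametricDist.norm_add_le_max _ _).trans (max_le (hi.trans ?_) ?_)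
    · exact zpow_le_zpow_right₀ (one_lt_prime_real p).le (by omega)
    · rw [norm_mul, norm_prime_zpow, neg_neg]
      have : ‖(i : ℚ_[p])‖ ≤ 1 := by exact_mod_cast Padic.norm_int_le_one (p := p) (i : ℤ)
      exact mul_le_of_le_one_left (by positivity) this

theorem haar_pball_succ (n : ℤ) : haar p (pball p (n + 1)) = p * haar p (pball p n) := by
  have hpr := prime_real_pos p
  rw [pball_eq_iUnion, measure_biUnion_finset]
  · simp [Measure.addHaar_closedBall_center, pball]
  · intro i hi j hj hij
    rw [Function.onFun, Set.disjoint_left]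
    intro x hx hx'
    rw [mem_closedBall_iff_norm] at hx hx'
    -- A common point of two of the translates forces `p ∣ i - j`, impossible for distinct digits.
    have h1 : ‖((i - j : ℤ) : ℚ_[p]) * (p : ℚ_[p]) ^ (-(n + 1))‖ ≤ (p : ℝ) ^ n := by
      have : ((i - j : ℤ) : ℚ_[p]) * (p : ℚ_[p]) ^ (-(n + 1))
          = (x - (j : ℚ_[p]) * (p : ℚ_[p]) ^ (-(n + 1)))
            - (x - (i : ℚ_[p]) * (p : ℚ_[p]) ^ (-(n + 1))) := by
        push_cast
        ring
      rw [this]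
      exact (norm_sub_le_max _ _).trans (max_le hx' hx)
    rw [norm_mul, norm_prime_zpow, neg_neg, ← le_div_iff₀ (by positivity),
      ← zpow_sub₀ hpr.ne', show n - (n + 1) = (-(1 : ℕ) : ℤ) by push_cast; ring,
      Padic.norm_int_le_pow_iff_dvd, pow_one] at h1
    apply hij
    simp only [Finset.coe_range, Set.mem_Iio] at hi hj
    have := Int.eq_zero_of_abs_lt_dvd h1 (by rw [abs_lt]; constructor <;> omega)
    omega
  · intro i _
    exact Metric.isClosed_closedBall.measurableSet

theorem haar_real_pball (n : ℤ) : (haar p).real (pball p n) = (p : ℝ) ^ n := by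
  have hpr := prime_real_pos p
  have hs : ∀ n : ℤ, (haar p).real (pball p (n + 1)) = p * (haar p).real (pball p n) := by
    intro n
    simp [Measure.real, haar_pball_succ]
  induction n using Int.induction_on with
  | zero => simp [Measure.real, pball_zero, haar_unitBall]
  | succ i ih => rw [hs, ih, zpow_add_one₀ hpr.ne', mul_comm]
  | pred i ih =>
    have := hs (-i - 1)
    rw [sub_add_cancel, ih] at this
    rw [zpow_sub_one₀ hpr.ne', this]
    field_simp

/-- On the dual ball the character is identically `1`. Off it, translating by a suitable `y` in the
ball preserves the ball and multiplies the integral by `chi (ξ * y) ≠ 1`, so the integral is zero.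
-/
theorem setIntegral_chi_pball (n : ℤ) (ξ : ℚ_[p]) :
    ∫ x in pball p n, chi (ξ * x) ∂(haar p)
      = (pball p (-n)).indicator (fun _ => (((p : ℝ) ^ n : ℝ) : ℂ)) ξ := by
  have hpr := prime_real_pos p
  by_cases hξ : ξ ∈ pball p (-n)
  · rw [Set.indicator_of_mem hξ, setIntegral_congr_fun (g := fun _ => 1) (measurableSet_pball n)]
    · simp [haar_real_pball]
    · intro x hx
      apply chi_eq_one
      rw [mem_pball] at hx hξ
      rw [norm_mul]
      calc ‖ξ‖ * ‖x‖ ≤ (p : ℝ) ^ (-n) * (p : ℝ) ^ n := by gcongr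
        _ = 1 := by rw [← zpow_add₀ hpr.ne']; simp
  · rw [Set.indicator_of_notMem hξ]
    -- An element of maximal norm in the ball, so that `|ξ y| > 1`.
    set y : ℚ_[p] := (p : ℚ_[p]) ^ (-n)
    have hy : ‖y‖ = (p : ℝ) ^ n := by rw [norm_prime_zpow, neg_neg]
    have hne : chi (ξ * y) ≠ 1 := fun h => hξ <| by
      have := norm_le_one_of_chi_eq_one h
      rw [norm_mul, hy] at this
      rw [mem_pball, zpow_neg, ← one_div, le_div_iff₀ (by positivity)]
      exact this
    have hshift : ∀ x, (pball p n).indicator (fun x => chi (ξ * x)) (x + y)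
        = chi (ξ * y) * (pball p n).indicator (fun x => chi (ξ * x)) x := by
      intro x
      have hmem : x + y ∈ pball p n ↔ x ∈ pball p n := by
        rw [mem_pball, mem_pball]
        constructor
        · intro h
          rw [← add_sub_cancel_right x y]
          exact (norm_sub_le_max _ _).trans (max_le h hy.le)
        · intro h
          exact (IsUltrametricDist.norm_add_le_max _ _).trans (max_le h hy.le)
      by_cases hx : x ∈ pball p n
      · rw [Set.indicator_of_mem hx, Set.indicator_of_mem (hmem.2 hx), mul_add, chi_add, mul_comm]
      · rw [Set.indicator_of_notMem hx, Set.indicator_of_notMem (fun h => hx (hmem.1 h)), mul_zero]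
    have h := integral_add_right_eq_self (μ := haar p)
      ((pball p n).indicator (fun x => chi (ξ * x))) y
    simp only [hshift] at h
    rw [integral_const_mul, integral_indicator (measurableSet_pball n)] at h
    have h' : (chi (ξ * y) - 1) * ∫ x in pball p n, chi (ξ * x) ∂(haar p) = 0 := by
      linear_combination h
    exact (mul_eq_zero.1 h').resolve_left (sub_ne_zero.2 hne)

/-! ### Exact Fourier transforms -/

theorem fourierTrunc_eq_pball (f : ℚ_[p] → ℂ) (n : ℕ) (ξ : ℚ_[p]) :
    fourierTrunc f n ξ = ∫ x in pball p n, chi (ξ * x) * f x ∂(haar p) := by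
  simp [fourierTrunc, pball]

instance isFiniteMeasure_restrict_pball (n : ℤ) :
    IsFiniteMeasure ((haar p).restrict (pball p n)) :=
  ⟨by simpa using (haar_pball_ne_top n).lt_top⟩

theorem integrableOn_pball (f : L2 p) (n : ℤ) : IntegrableOn f (pball p n) (haar p) :=
  ((Lp.memLp f).restrict _).integrable (by norm_num)

theorem integrableOn_chi_mul (f : L2 p) (n : ℤ) (ξ : ℚ_[p]) :
    IntegrableOn (fun x => chi (ξ * x) * f x) (pball p n) (haar p) :=
  (integrableOn_pball f n).bdd_mul
    (continuous_chi.comp (continuous_const.mul continuous_id)).aestronglyMeasurable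
    (c := 1) (Eventually.of_forall fun _ => (norm_chi _).le)

theorem fourierTrunc_congr {f g : ℚ_[p] → ℂ} (h : f =ᵐ[haar p] g) (n : ℕ) (ξ : ℚ_[p]) :
    fourierTrunc f n ξ = fourierTrunc g n ξ := by
  refine integral_congr_ae (ae_restrict_of_ae ?_)
  filter_upwards [h] with x hx
  rw [hx]

theorem fourierTrunc_add (f g : L2 p) (n : ℕ) (ξ : ℚ_[p]) :
    fourierTrunc (f + g : L2 p) n ξ = fourierTrunc f n ξ + fourierTrunc g n ξ := by
  rw [fourierTrunc_congr (Lp.coeFn_add f g)]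
  simp only [fourierTrunc_eq_pball, Pi.add_apply, mul_add]
  exact integral_add (integrableOn_chi_mul f n ξ) (integrableOn_chi_mul g n ξ)

theorem fourierTrunc_smul (c : ℂ) (f : L2 p) (n : ℕ) (ξ : ℚ_[p]) :
    fourierTrunc (c • f : L2 p) n ξ = c * fourierTrunc f n ξ := by
  rw [fourierTrunc_congr (Lp.coeFn_smul c f)]
  simp only [fourierTrunc_eq_pball, Pi.smul_apply, smul_eq_mul]
  rw [← integral_const_mul]
  congr 1 with x
  ring

/-- All truncated Fourier integrals of `f` from some radius on are equal to `g`. -/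
def ExactFourier (f : L2 p) (g : ℚ_[p] → ℂ) : Prop :=
  ∃ N : ℕ, ∀ n, N ≤ n → ∀ ξ, fourierTrunc f n ξ = g ξ

theorem ExactFourier.add {f₁ f₂ : L2 p} {g₁ g₂ : ℚ_[p] → ℂ} (h₁ : ExactFourier f₁ g₁)
    (h₂ : ExactFourier f₂ g₂) : ExactFourier (f₁ + f₂) fun ξ => g₁ ξ + g₂ ξ := by
  obtain ⟨N₁, h₁⟩ := h₁
  obtain ⟨N₂, h₂⟩ := h₂
  refine ⟨max N₁ N₂, fun n hn ξ => ?_⟩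
  rw [fourierTrunc_add, h₁ n (le_of_max_le_left hn), h₂ n (le_of_max_le_right hn)]

theorem ExactFourier.smul (c : ℂ) {f : L2 p} {g : ℚ_[p] → ℂ} (h : ExactFourier f g) :
    ExactFourier (c • f) fun ξ => c * g ξ := by
  obtain ⟨N, h⟩ := h
  exact ⟨N, fun n hn ξ => by rw [fourierTrunc_smul, h n hn]⟩

theorem ExactFourier.sub {f₁ f₂ : L2 p} {g₁ g₂ : ℚ_[p] → ℂ} (h₁ : ExactFourier f₁ g₁)
    (h₂ : ExactFourier f₂ g₂) : ExactFourier (f₁ - f₂) fun ξ => g₁ ξ - g₂ ξ := by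
  have := h₁.add (h₂.smul (-1))
  simpa [sub_eq_add_neg] using this

theorem ExactFourier.isFourier {f g : L2 p} {g' : ℚ_[p] → ℂ} (h : ExactFourier f g')
    (hg : g =ᵐ[haar p] g') : IsFourier f g := by
  obtain ⟨N, h⟩ := h
  refine tendsto_const_nhds.congr' ?_
  filter_upwards [eventually_ge_atTop N] with n hn
  symm
  rw [eLpNorm_congr_ae (g := 0), eLpNorm_zero]
  filter_upwards [hg] with ξ hξ
  simp [h n hn, hξ]

theorem ExactFourier.isInvFourier {k h : L2 p} {h' : ℚ_[p] → ℂ} (hk : ExactFourier k h')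
    (hh : h =ᵐ[haar p] fun x => h' (-x)) : IsInvFourier k h := by
  obtain ⟨N, hk⟩ := hk
  refine tendsto_const_nhds.congr' ?_
  filter_upwards [eventually_ge_atTop N] with n hn
  symm
  rw [eLpNorm_congr_ae (g := 0), eLpNorm_zero]
  filter_upwards [hh] with ξ hξ
  simp [hk n hn, hξ]

/-- `η = H Φ`, where all the Fourier integrals involved are eventually constant in the radius of
truncation. -/
def ExactHamiltonian (α mα : ℝ) (Φ η : L2 p) : Prop :=
  (∀ᵐ x ∂(haar p), x ∉ pball p 0 → Φ x = 0) ∧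
    ∃ (g k h : L2 p) (g' h' : ℚ_[p] → ℂ), ExactFourier Φ g' ∧ g =ᵐ[haar p] g' ∧
      (k =ᵐ[haar p] fun ξ => ((‖ξ‖ ^ α : ℝ) : ℂ) * g ξ) ∧
      ExactFourier k h' ∧ (h =ᵐ[haar p] fun x => h' (-x)) ∧
      η =ᵐ[haar p] (pball p 0).indicator fun x => (mα : ℂ) * h x

theorem ExactHamiltonian.isHamiltonian {α mα : ℝ} {Φ η : L2 p} (H : ExactHamiltonian α mα Φ η) :
    IsHamiltonian α mα Φ η := by
  obtain ⟨h0, g, k, h, g', h', h1, h2, h3, h4, h5, h6⟩ := H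
  rw [pball_zero] at h0 h6
  exact ⟨h0, h, ⟨g, k, h1.isFourier h2, h3, h4.isInvFourier h5⟩, h6⟩

theorem ExactHamiltonian.add {α mα : ℝ} {Φ₁ η₁ Φ₂ η₂ : L2 p} (H₁ : ExactHamiltonian α mα Φ₁ η₁)
    (H₂ : ExactHamiltonian α mα Φ₂ η₂) : ExactHamiltonian α mα (Φ₁ + Φ₂) (η₁ + η₂) := by
  obtain ⟨a0, g₁, k₁, h₁, g₁', h₁', a1, a2, a3, a4, a5, a6⟩ := H₁
  obtain ⟨b0, g₂, k₂, h₂, g₂', h₂', b1, b2, b3, b4, b5, b6⟩ := H₂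
  refine ⟨?_, g₁ + g₂, k₁ + k₂, h₁ + h₂, _, _, a1.add b1, ?_, ?_, a4.add b4, ?_, ?_⟩
  · filter_upwards [a0, b0, Lp.coeFn_add Φ₁ Φ₂] with x h1 h2 h3 hx
    rw [h3, Pi.add_apply, h1 hx, h2 hx, add_zero]
  · filter_upwards [a2, b2, Lp.coeFn_add g₁ g₂] with x h1 h2 h3
    rw [h3, Pi.add_apply, h1, h2]
  · filter_upwards [a3, b3, Lp.coeFn_add g₁ g₂, Lp.coeFn_add k₁ k₂] with x h1 h2 h3 h4
    rw [h4, h3, Pi.add_apply, Pi.add_apply, h1, h2, mul_add]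
  · filter_upwards [a5, b5, Lp.coeFn_add h₁ h₂] with x h1 h2 h3
    rw [h3, Pi.add_apply, h1, h2]
  · filter_upwards [a6, b6, Lp.coeFn_add h₁ h₂, Lp.coeFn_add η₁ η₂] with x h1 h2 h3 h4
    rw [h4, Pi.add_apply, h1, h2]
    by_cases hx : x ∈ pball p 0
    · simp only [hx, Set.indicator_of_mem]
      rw [h3, Pi.add_apply, mul_add]
    · simp [hx]

theorem ExactHamiltonian.smul {α mα : ℝ} (c : ℂ) {Φ η : L2 p} (H : ExactHamiltonian α mα Φ η) :
    ExactHamiltonian α mα (c • Φ) (c • η) := by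
  obtain ⟨a0, g, k, h, g', h', a1, a2, a3, a4, a5, a6⟩ := H
  refine ⟨?_, c • g, c • k, c • h, _, _, a1.smul c, ?_, ?_, a4.smul c, ?_, ?_⟩
  · filter_upwards [a0, Lp.coeFn_smul c Φ] with x h1 h3 hx
    simp [h3, h1 hx]
  · filter_upwards [a2, Lp.coeFn_smul c g] with x h1 h3
    simp [h1, h3]
  · filter_upwards [a3, Lp.coeFn_smul c g, Lp.coeFn_smul c k] with x h1 h3 h4
    simp only [h1, h3, h4, Pi.smul_apply, smul_eq_mul]
    ring
  · filter_upwards [a5, Lp.coeFn_smul c h] with x h1 h3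
    simp [h1, h3]
  · filter_upwards [a6, Lp.coeFn_smul c h, Lp.coeFn_smul c η] with x h1 h3 h4
    rw [h4, Pi.smul_apply, h1]
    by_cases hx : x ∈ pball p 0
    · simp only [hx, Set.indicator_of_mem, h3, Pi.smul_apply, smul_eq_mul]
      ring
    · simp [hx]

/-! ### Characteristic functions of balls -/

/-- The characteristic function of the ball `{x : |x|_p ≤ p ^ n}`. -/
def ind (p : ℕ) [Fact p.Prime] (n : ℤ) : ℚ_[p] → ℂ := (pball p n).indicator fun _ => 1

theorem ind_of_mem {n : ℤ} {x : ℚ_[p]} (h : x ∈ pball p n) : ind p n x = 1 :=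
  Set.indicator_of_mem h _

theorem ind_of_notMem {n : ℤ} {x : ℚ_[p]} (h : x ∉ pball p n) : ind p n x = 0 :=
  Set.indicator_of_notMem h _

theorem ind_neg_apply (n : ℤ) (x : ℚ_[p]) : ind p n (-x) = ind p n x := by
  have : -x ∈ pball p n ↔ x ∈ pball p n := by rw [mem_pball, mem_pball, norm_neg]
  by_cases h : x ∈ pball p n
  · rw [ind_of_mem h, ind_of_mem (this.2 h)]
  · rw [ind_of_notMem h, ind_of_notMem (fun h' => h (this.1 h'))]

theorem mem_pball_iff_of_norm_eq {n m : ℤ} {x : ℚ_[p]} (h : ‖x‖ = (p : ℝ) ^ m) :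
    x ∈ pball p n ↔ m ≤ n := by
  rw [mem_pball, h, zpow_le_zpow_iff_right₀ (one_lt_prime_real p)]

theorem ind_of_norm_eq {n m : ℤ} {x : ℚ_[p]} (h : ‖x‖ = (p : ℝ) ^ m) :
    ind p n x = if m ≤ n then 1 else 0 := by
  split_ifs with h'
  · exact ind_of_mem ((mem_pball_iff_of_norm_eq h).2 h')
  · exact ind_of_notMem fun h2 => h' ((mem_pball_iff_of_norm_eq h).1 h2)

/-- The characteristic function of the ball `{x : |x|_p ≤ p ^ n}` as an element of `L²`. -/
def ballLp (p : ℕ) [Fact p.Prime] (n : ℤ) : L2 p :=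
  indicatorConstLp 2 (measurableSet_pball n) (haar_pball_ne_top n) 1

theorem coeFn_ballLp (n : ℤ) : ballLp p n =ᵐ[haar p] ind p n := indicatorConstLp_coeFn

theorem norm_ballLp (n : ℤ) : ‖ballLp p n‖ = (p : ℝ) ^ ((n : ℝ) / 2) := by
  rw [ballLp, norm_indicatorConstLp (by norm_num) (by norm_num), haar_real_pball]
  rw [← Real.rpow_intCast, ← Real.rpow_mul (prime_real_pos p).le]
  simp [div_eq_mul_inv]

theorem fourierTrunc_ballLp {m : ℤ} {n : ℕ} (h : m ≤ n) (ξ : ℚ_[p]) :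
    fourierTrunc (ballLp p m) n ξ = (((p : ℝ) ^ m : ℝ) : ℂ) * ind p (-m) ξ := by
  rw [fourierTrunc_congr (coeFn_ballLp m), fourierTrunc_eq_pball]
  have : (fun x => chi (ξ * x) * ind p m x) = (pball p m).indicator fun x => chi (ξ * x) := by
    ext x
    by_cases hx : x ∈ pball p m <;> simp [ind, hx]
  rw [this, setIntegral_indicator (measurableSet_pball m),
    Set.inter_eq_self_of_subset_right (pball_mono h), setIntegral_chi_pball]
  by_cases hx : ξ ∈ pball p (-m) <;> simp [ind, hx]

theorem exactFourier_ballLp (m : ℤ) :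
    ExactFourier (ballLp p m) fun ξ => (((p : ℝ) ^ m : ℝ) : ℂ) * ind p (-m) ξ :=
  ⟨m.toNat, fun _ hn ξ => fourierTrunc_ballLp (by omega) ξ⟩

/-! ### Eigenfunctions -/

/-- `p 1_{p^{m+1}ℤ_p} - 1_{p^m ℤ_p}`, the sum over `k` of the Kozyrev wavelets supported in
`p ^ m ℤ_p`. -/
def waveletLp (p : ℕ) [Fact p.Prime] (m : ℕ) : L2 p :=
  (p : ℂ) • ballLp p (-(m + 1 : ℤ)) - ballLp p (-(m : ℤ))

theorem coeFn_waveletLp (m : ℕ) : waveletLp p m =ᵐ[haar p] fun x =>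
    p * ind p (-(m + 1 : ℤ)) x - ind p (-(m : ℤ)) x := by
  filter_upwards [Lp.coeFn_sub ((p : ℂ) • ballLp p (-(m + 1 : ℤ))) (ballLp p (-(m : ℤ))),
    Lp.coeFn_smul (p : ℂ) (ballLp p (-(m + 1 : ℤ))), coeFn_ballLp (p := p) (-(m + 1 : ℤ)),
    coeFn_ballLp (p := p) (-(m : ℤ))] with x h1 h2 h3 h4
  rw [waveletLp, h1, Pi.sub_apply, h2, Pi.smul_apply, h3, h4, smul_eq_mul]

/-- The transform is `p^{-m}` times the indicator of the sphere `|ξ| = p^{m+1}`, on which the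
multiplier is the constant `p^{(m+1)α}`. Thus `D^α` only rescales, and the cut-off does nothing
since the function already lives in `ℤ_p`. -/
theorem exactHamiltonian_waveletLp (α mα : ℝ) (m : ℕ) :
    ExactHamiltonian α mα (waveletLp p m) ((energy p α mα m : ℂ) • waveletLp p m) := by
  have hpr := prime_real_pos p
  set c : ℂ := (((p : ℝ) ^ (-(m : ℤ)) : ℝ) : ℂ) with hc
  set d : ℂ := (((p : ℝ) ^ ((1 + (m : ℝ)) * α) : ℝ) : ℂ) with hd
  have hc' : (p : ℂ) * (((p : ℝ) ^ (-(m + 1 : ℤ)) : ℝ) : ℂ) = c := by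
    rw [hc, neg_add, zpow_add₀ hpr.ne']
    push_cast
    rw [zpow_neg_one, mul_comm, mul_assoc, inv_mul_cancel₀ (by exact_mod_cast hpr.ne'), mul_one]
  have hc'' : c * (((p : ℝ) ^ (m : ℤ) : ℝ) : ℂ) = 1 := by
    rw [hc, ← Complex.ofReal_mul, ← zpow_add₀ hpr.ne']
    simp
  have hc3 : c * (((p : ℝ) ^ (m + 1 : ℤ) : ℝ) : ℂ) = p := by
    rw [hc, ← Complex.ofReal_mul, ← zpow_add₀ hpr.ne']
    simp
  have hw := coeFn_waveletLp (p := p) m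
  have hout : ∀ᵐ x ∂(haar p), x ∉ pball p 0 → waveletLp p m x = 0 := by
    filter_upwards [hw] with x hx h
    rw [hx, ind_of_notMem fun h' => h (pball_mono (by omega) h'),
      ind_of_notMem fun h' => h (pball_mono (by omega) h')]
    simp
  let g : L2 p := c • (ballLp p (m + 1) - ballLp p m)
  have hg : g =ᵐ[haar p] fun ξ => c * (ind p (m + 1) ξ - ind p m ξ) := by
    filter_upwards [Lp.coeFn_smul c (ballLp p (m + 1) - ballLp p m),
      Lp.coeFn_sub (ballLp p (m + 1)) (ballLp p m), coeFn_ballLp (p := p) (m + 1),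
      coeFn_ballLp (p := p) m] with x h1 h2 h3 h4
    rw [h1, Pi.smul_apply, h2, Pi.sub_apply, h3, h4, smul_eq_mul]
  refine ⟨hout, g, d • g, d • waveletLp p m, _, _,
    ((exactFourier_ballLp _).smul (p : ℂ)).sub (exactFourier_ballLp _), ?_, ?_,
    (((exactFourier_ballLp _).sub (exactFourier_ballLp _)).smul c).smul d, ?_, ?_⟩
  · filter_upwards [hg] with ξ hξ
    rw [hξ, ← mul_assoc, hc', neg_neg, neg_neg]
    ring
  · filter_upwards [hg, Lp.coeFn_smul d g] with ξ h1 h2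
    rw [h2, Pi.smul_apply, h1, smul_eq_mul]
    by_cases h3 : ξ ∈ pball p (m + 1)
    · by_cases h4 : ξ ∈ pball p m
      · rw [ind_of_mem h3, ind_of_mem h4]
        simp
      · have h0 : ξ ≠ 0 := by
          rintro rfl
          exact h4 (by rw [mem_pball, norm_zero]; positivity)
        have hn := Padic.norm_eq_zpow_neg_valuation h0
        rw [mem_pball_iff_of_norm_eq hn] at h3 h4
        have : -ξ.valuation = m + 1 := by omega
        rw [this] at hn
        congr 2
        rw [hn, ← Real.rpow_intCast, ← Real.rpow_mul hpr.le, hd]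
        push_cast
        ring_nf
    · rw [ind_of_notMem h3, ind_of_notMem fun h4 => h3 (pball_mono (by omega) h4)]
      simp
  · filter_upwards [hw, Lp.coeFn_smul d (waveletLp p m)] with x h1 h2
    rw [h2, Pi.smul_apply, h1, smul_eq_mul, ind_neg_apply, ind_neg_apply]
    linear_combination (-d * ind p (-(m + 1 : ℤ)) x) * hc3 + (d * ind p (-(m : ℤ)) x) * hc''
  · filter_upwards [hout, Lp.coeFn_smul d (waveletLp p m),
      Lp.coeFn_smul (energy p α mα m : ℂ) (waveletLp p m)] with x h1 h2 h3
    rw [h3, Pi.smul_apply]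
    by_cases hx : x ∈ pball p 0
    · rw [Set.indicator_of_mem hx, h2, Pi.smul_apply, energy, hd]
      push_cast
      simp only [smul_eq_mul]
      ring
    · rw [Set.indicator_of_notMem hx, h1 hx, smul_zero]

theorem tsum_enorm_ne_top_of_summable_norm {E : Type*} [SeminormedAddCommGroup E] {f : ℕ → E}
    (h : Summable fun n => ‖f n‖) : ∑' n, ‖f n‖ₑ ≠ ⊤ :=
  ENNReal.tsum_coe_ne_top_iff_summable.2 (NNReal.summable_coe.1 h)

/-- The function `|ξ|^α 1_{ℤ_p}` is expanded over the spheres `|ξ| = p^{-j}` and transformed term by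
term. `D^α 1_{ℤ_p}` does not vanish outside `ℤ_p` in general; only its restriction to `ℤ_p` enters.
-/
theorem exactHamiltonian_ballLp_zero {α : ℝ} (hα : 0 < α) (mα : ℝ) :
    ExactHamiltonian α mα (ballLp p 0) ((energyGnd p α mα : ℂ) • ballLp p 0) := by
  have hpr := prime_real_pos p
  have hp1 := one_lt_prime_real p
  set q : ℝ := (p : ℝ) ^ (-α) with hq
  have hq0 : 0 < q := by positivity
  have hq1 : q < 1 := Real.rpow_lt_one_of_one_lt_of_neg hp1 (by linarith)
  have hsum : Summable fun j : ℕ => q ^ j * 2 :=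
    (summable_geometric_of_lt_one hq0.le hq1).mul_right 2
  -- The part of `|ξ|^α 1_{ℤ_p}` on `|ξ| = p^{-j}`, where the multiplier is `q^j`; `tr j` is its
  -- transform.
  let layer : ℕ → L2 p := fun j =>
    ((q ^ j : ℝ) : ℂ) • (ballLp p (-(j : ℤ)) - ballLp p (-(j + 1 : ℤ)))
  let tr : ℕ → L2 p := fun j =>
    ((q ^ j : ℝ) : ℂ) • ((((p : ℝ) ^ (-(j : ℤ)) : ℝ) : ℂ) • ballLp p j
      - (((p : ℝ) ^ (-(j + 1 : ℤ)) : ℝ) : ℂ) • ballLp p (j + 1))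
  have hlayer : ∀ j, layer j =ᵐ[haar p] fun ξ =>
      ((q ^ j : ℝ) : ℂ) * (ind p (-(j : ℤ)) ξ - ind p (-(j + 1 : ℤ)) ξ) := by
    intro j
    filter_upwards [Lp.coeFn_smul ((q ^ j : ℝ) : ℂ)
        (ballLp p (-(j : ℤ)) - ballLp p (-(j + 1 : ℤ))),
      Lp.coeFn_sub (ballLp p (-(j : ℤ))) (ballLp p (-(j + 1 : ℤ))),
      coeFn_ballLp (p := p) (-(j : ℤ)), coeFn_ballLp (p := p) (-(j + 1 : ℤ))] with x h1 h2 h3 h4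
    rw [h1, Pi.smul_apply, h2, Pi.sub_apply, h3, h4, smul_eq_mul]
  have htr : ∀ j, tr j =ᵐ[haar p] fun x =>
      ((q ^ j : ℝ) : ℂ) * ((((p : ℝ) ^ (-(j : ℤ)) : ℝ) : ℂ) * ind p j x
        - (((p : ℝ) ^ (-(j + 1 : ℤ)) : ℝ) : ℂ) * ind p (j + 1) x) := by
    intro j
    filter_upwards [Lp.coeFn_smul ((q ^ j : ℝ) : ℂ) ((((p : ℝ) ^ (-(j : ℤ)) : ℝ) : ℂ) • ballLp p j
        - (((p : ℝ) ^ (-(j + 1 : ℤ)) : ℝ) : ℂ) • ballLp p (j + 1)),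
      Lp.coeFn_sub ((((p : ℝ) ^ (-(j : ℤ)) : ℝ) : ℂ) • ballLp p j)
        ((((p : ℝ) ^ (-(j + 1 : ℤ)) : ℝ) : ℂ) • ballLp p (j + 1)),
      Lp.coeFn_smul (((p : ℝ) ^ (-(j : ℤ)) : ℝ) : ℂ) (ballLp p j),
      Lp.coeFn_smul (((p : ℝ) ^ (-(j + 1 : ℤ)) : ℝ) : ℂ) (ballLp p (j + 1)),
      coeFn_ballLp (p := p) j, coeFn_ballLp (p := p) (j + 1)] with x h1 h2 h3 h4 h5 h6
    rw [h1, Pi.smul_apply, h2, Pi.sub_apply, h3, h4, Pi.smul_apply, Pi.smul_apply, h5, h6,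
      smul_eq_mul, smul_eq_mul, smul_eq_mul]
  have hball : ∀ n : ℤ, n ≤ 0 → ‖ballLp p n‖ ≤ 1 := by
    intro n hn
    rw [norm_ballLp]
    exact Real.rpow_le_one_of_one_le_of_nonpos hp1.le (by
      have : (n : ℝ) ≤ 0 := by exact_mod_cast hn
      linarith)
  have hball' : ∀ n : ℤ, 0 ≤ n → ‖(((p : ℝ) ^ (-n) : ℝ) : ℂ) • ballLp p n‖ ≤ 1 := by
    intro n hn
    rw [norm_smul, norm_ballLp, Complex.norm_real, Real.norm_of_nonneg (by positivity),
      ← Real.rpow_intCast, ← Real.rpow_add hpr]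
    refine Real.rpow_le_one_of_one_le_of_nonpos hp1.le ?_
    have : (0 : ℝ) ≤ n := by exact_mod_cast hn
    push_cast
    linarith
  have hnorm : ∀ (j : ℕ) (a b : L2 p), ‖a‖ ≤ 1 → ‖b‖ ≤ 1 →
      ‖((q ^ j : ℝ) : ℂ) • (a - b)‖ ≤ q ^ j * 2 := by
    intro j a b ha hb
    rw [norm_smul, Complex.norm_real, Real.norm_of_nonneg (by positivity)]
    gcongr
    linarith [norm_sub_le a b]
  have hsl : Summable fun j => ‖layer j‖ := Summable.of_nonneg_of_le (fun _ => norm_nonneg _)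
    (fun j => hnorm j _ _ (hball _ (by omega)) (hball _ (by omega))) hsum
  have hst : Summable fun j => ‖tr j‖ := Summable.of_nonneg_of_le (fun _ => norm_nonneg _)
    (fun j => hnorm j _ _ (hball' _ (by omega)) (hball' (j + 1) (by omega))) hsum
  have hkl := Lp.hasSum_coeFn_tsum (tsum_enorm_ne_top_of_summable_norm hsl)
  have hhl := Lp.hasSum_coeFn_tsum (tsum_enorm_ne_top_of_summable_norm hst)
  have hlayer' := ae_all_iff.2 hlayer
  have htr' := ae_all_iff.2 htr
  have hfour : ∀ (j n : ℕ) (ξ : ℚ_[p]), fourierTrunc (layer j) n ξ =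
      ((q ^ j : ℝ) : ℂ) * ((((p : ℝ) ^ (-(j : ℤ)) : ℝ) : ℂ) * ind p j ξ
        - (((p : ℝ) ^ (-(j + 1 : ℤ)) : ℝ) : ℂ) * ind p (j + 1) ξ) := by
    intro j n ξ
    have h1 : layer j = ((q ^ j : ℝ) : ℂ) •
        (ballLp p (-(j : ℤ)) + (-1 : ℂ) • ballLp p (-(j + 1 : ℤ))) := by
      rw [neg_one_smul, ← sub_eq_add_neg]
    rw [h1, fourierTrunc_smul, fourierTrunc_add, fourierTrunc_smul,
      fourierTrunc_ballLp (by omega), fourierTrunc_ballLp (by omega), neg_neg, neg_neg]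
    ring
  -- Sum and integral are exchanged using the pointwise bound `2 q^j` on a ball of finite measure.
  have hkfour : ∀ (n : ℕ) (ξ : ℚ_[p]), HasSum (fun j => fourierTrunc (layer j) n ξ)
      (fourierTrunc (∑' j, layer j : L2 p) n ξ) := by
    intro n ξ
    have hint := fun j => integrableOn_chi_mul (layer j) n ξ
    have := hasSum_integral_of_summable_integral_norm hint ?_
    · have h2 : ∫ x in pball p n, ∑' j, chi (ξ * x) * layer j x ∂(haar p)
          = fourierTrunc (∑' j, layer j : L2 p) n ξ := by
        rw [fourierTrunc_eq_pball]
        refine integral_congr_ae (ae_restrict_of_ae ?_)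
        filter_upwards [hkl] with x hx
        exact (hx.mul_left _).tsum_eq
      rw [h2] at this
      simpa only [fourierTrunc_eq_pball] using this
    · refine Summable.of_nonneg_of_le (fun _ => integral_nonneg fun _ => norm_nonneg _)
        (fun j => ?_) (hsum.mul_right ((haar p).real (pball p n)))
      rw [← Real.norm_of_nonneg (integral_nonneg fun _ => norm_nonneg _)]
      refine norm_setIntegral_le_of_norm_le_const_ae (haar_pball_ne_top n).lt_top
        (ae_restrict_of_ae ?_)
      filter_upwards [hlayer j] with x hx
      rw [norm_norm, norm_mul, norm_chi, one_mul, hx, norm_mul, Complex.norm_real,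
        Real.norm_of_nonneg (by positivity)]
      gcongr
      refine (norm_sub_le _ _).trans ?_
      have : ∀ n x, ‖ind p n x‖ ≤ 1 := fun n x => by
        by_cases h : x ∈ pball p n
        · simp [ind_of_mem h]
        · simp [ind_of_notMem h]
      linarith [this (-(j : ℤ)) x, this (-(j + 1 : ℤ)) x]
  refine ⟨?_, ballLp p 0, ∑' j, layer j, ∑' j, tr j, _,
    fun ξ => fourierTrunc (∑' j, layer j : L2 p) 0 ξ, exactFourier_ballLp 0, ?_, ?_,
    ⟨0, fun n _ ξ => ?_⟩, ?_, ?_⟩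
  · filter_upwards [coeFn_ballLp (p := p) 0] with x hx h
    rw [hx, ind_of_notMem h]
  · filter_upwards [coeFn_ballLp (p := p) 0] with x hx
    simp [hx]
  · filter_upwards [coeFn_ballLp (p := p) 0, hkl, hlayer'] with ξ h1 h2 h3
    refine h2.unique ?_
    simp only [h3, h1]
    by_cases h0 : ξ = 0
    · subst h0
      have : ∀ n, ind p n 0 = 1 := fun n => ind_of_mem (by rw [mem_pball, norm_zero]; positivity)
      -- At the origin every layer vanishes, which matches `0^α = 0` because `α ≠ 0`.
      simp [this, Real.zero_rpow hα.ne', hasSum_zero]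
    have hn := Padic.norm_eq_zpow_neg_valuation h0
    simp only [ind_of_norm_eq hn]
    by_cases hv : ξ.valuation < 0
    · rw [if_neg (by omega), mul_zero]
      convert! hasSum_zero with j
      rw [if_neg (by omega), if_neg (by omega)]
      simp
    · obtain ⟨j₀, hj₀⟩ := Int.eq_ofNat_of_zero_le (not_lt.1 hv)
      have h4 : (((‖ξ‖ ^ α : ℝ) : ℂ) * if -ξ.valuation ≤ 0 then 1 else 0)
          = ((q ^ j₀ : ℝ) : ℂ) * ((if -ξ.valuation ≤ -(j₀ : ℤ) then 1 else 0)
            - if -ξ.valuation ≤ -(j₀ + 1 : ℤ) then 1 else 0) := by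
        rw [if_pos (by omega), if_pos (by omega), if_neg (by omega), sub_zero]
        congr 2
        rw [hn, hj₀, hq, ← Real.rpow_intCast, ← Real.rpow_natCast, ← Real.rpow_mul hpr.le,
          ← Real.rpow_mul hpr.le]
        push_cast
        ring_nf
      rw [h4]
      refine hasSum_single j₀ fun j hj => ?_
      by_cases h5 : j ≤ j₀
      · rw [if_pos (by omega), if_pos (by omega)]
        simp
      · rw [if_neg (by omega), if_neg (by omega)]
        simp
  -- All layers lie in `ℤ_p`, so their truncated integrals do not depend on the radius `p^n`.
  · refine (hkfour n ξ).unique ?_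
    have := hkfour 0 ξ
    simpa only [hfour] using this
  · filter_upwards [hhl, htr'] with x h1 h2
    refine h1.unique ?_
    have := hkfour 0 (-x)
    simpa only [hfour, h2, ind_neg_apply] using this
  · filter_upwards [coeFn_ballLp (p := p) 0, hhl, htr',
      Lp.coeFn_smul (energyGnd p α mα : ℂ) (ballLp p 0)] with x h1 h2 h3 h4
    rw [h4, Pi.smul_apply, h1]
    by_cases hx : x ∈ pball p 0
    · rw [Set.indicator_of_mem hx, ind_of_mem hx, smul_eq_mul, mul_one, energyGnd]
      push_cast
      congr 1
      refine HasSum.unique ?_ h2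
      simp only [h3]
      -- For `x ∈ ℤ_p` all indicators in the series equal `1`, leaving `(1 - p⁻¹) ∑ (q/p)^j`.
      have hin : ∀ n : ℤ, 0 ≤ n → ind p n x = 1 := fun n hn => ind_of_mem (pball_mono hn hx)
      have hqp : (p : ℝ) ^ (-α - 1) = q * (p : ℝ)⁻¹ := by
        rw [hq, Real.rpow_sub hpr, Real.rpow_one, div_eq_mul_inv]
      have hlt : q * (p : ℝ)⁻¹ < 1 := by
        have : (p : ℝ)⁻¹ < 1 := inv_lt_one_of_one_lt₀ hp1
        have h0 : (0 : ℝ) < (p : ℝ)⁻¹ := by positivity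
        nlinarith
      have hgeo := (hasSum_geometric_of_lt_one (by positivity) hlt).mul_left (1 - (p : ℝ)⁻¹)
      rw [← hqp, ← div_eq_mul_inv] at hgeo
      have hgeo' := Complex.hasSum_ofReal.2 hgeo
      push_cast at hgeo'
      convert! hgeo' using 1
      · ext j
        rw [hin j (by omega), hin (j + 1) (by omega), neg_add, zpow_add₀ hpr.ne', zpow_neg,
          zpow_natCast, zpow_neg_one, hqp]
        push_cast
        rw [mul_pow, inv_pow]
        ring
    · rw [Set.indicator_of_notMem hx, ind_of_notMem hx, smul_zero]

/-! ### Symmetry of the Hamiltonian -/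

theorem continuous_chi_mul : Continuous fun z : ℚ_[p] × ℚ_[p] => chi (z.1 * z.2) :=
  continuous_chi.comp (continuous_fst.mul continuous_snd)

theorem aestronglyMeasurable_fourierTrunc (f : L2 p) (n : ℕ) :
    AEStronglyMeasurable (fourierTrunc f n) (haar p) := by
  have h : AEStronglyMeasurable (fun z : ℚ_[p] × ℚ_[p] => chi (z.1 * z.2) * f z.2)
      ((haar p).prod ((haar p).restrict (pball p n))) :=
    continuous_chi_mul.aestronglyMeasurable.mul
      (integrableOn_pball f n).aestronglyMeasurable.comp_snd
  exact h.integral_prod_right'.congr (Eventually.of_forall fun ξ =>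
    (fourierTrunc_eq_pball f n ξ).symm)

/-- Fubini on a product of two balls: the factor `chi (-x ξ)` is the conjugate of `chi (ξ x)` and is
absorbed into the transform of `f`. -/
theorem setIntegral_conj_mul_fourierTrunc_neg (f k : L2 p) (N n : ℕ) :
    ∫ x in pball p N, (starRingEnd ℂ) (f x) * fourierTrunc k n (-x) ∂(haar p)
      = ∫ ξ in pball p n, (starRingEnd ℂ) (fourierTrunc f N ξ) * k ξ ∂(haar p) := by
  have hf : Integrable (fun x => (starRingEnd ℂ) (f x)) ((haar p).restrict (pball p N)) :=
    (LinearIsometryEquiv.integrable_comp_iff Complex.conjLIE).2 (integrableOn_pball f N)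
  have hint : Integrable (Function.uncurry fun x ξ =>
      chi (-x * ξ) * ((starRingEnd ℂ) (f x) * k ξ))
      (((haar p).restrict (pball p N)).prod ((haar p).restrict (pball p n))) :=
    (hf.mul_prod (integrableOn_pball k n)).bdd_mul
      (continuous_chi.comp (continuous_fst.neg.mul continuous_snd)).aestronglyMeasurable
      (c := 1) (Eventually.of_forall fun _ => (norm_chi _).le)
  have h := integral_integral_swap hint
  calc _ = ∫ x in pball p N, ∫ ξ in pball p n,
        chi (-x * ξ) * ((starRingEnd ℂ) (f x) * k ξ) ∂(haar p) ∂(haar p) := by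
        congr 1 with x
        rw [fourierTrunc_eq_pball, ← integral_const_mul]
        congr 1 with ξ
        ring
    _ = _ := h
    _ = _ := by
        congr 1 with ξ
        rw [fourierTrunc_eq_pball, ← integral_conj, ← integral_mul_const]
        congr 1 with x
        rw [map_mul, ← chi_neg, mul_comm ξ x, neg_mul]
        ring

theorem fourierTrunc_eq_zero_radius {f : L2 p} (hf : ∀ᵐ x ∂(haar p), x ∉ pball p 0 → f x = 0)
    (n : ℕ) (ξ : ℚ_[p]) : fourierTrunc f n ξ = fourierTrunc f 0 ξ := by
  rw [fourierTrunc_eq_pball, fourierTrunc_eq_pball]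
  refine setIntegral_eq_of_subset_of_ae_sdiff_eq_zero (measurableSet_pball _).nullMeasurableSet
    (pball_mono (by omega)) ?_
  filter_upwards [hf] with x hx h
  rw [hx h.2, mul_zero]

theorem iUnion_pball : ⋃ n : ℕ, pball p n = Set.univ := by
  refine Set.eq_univ_of_forall fun x => Set.mem_iUnion.2 ?_
  obtain ⟨n, hn⟩ := pow_unbounded_of_one_lt ‖x‖ (one_lt_prime_real p)
  exact ⟨n, by rw [mem_pball, zpow_natCast]; exact hn.le⟩

/-- This adjunction between the transform and its inverse replaces Plancherel. The support of `f`
makes its truncated transforms stationary, so only the truncation of `k` has to pass to the limit.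
-/
theorem inner_eq_of_isFourier {f g k h : L2 p}
    (hf : ∀ᵐ x ∂(haar p), x ∉ pball p 0 → f x = 0) (hfg : IsFourier f g)
    (hkh : IsInvFourier k h) : inner ℂ f h = inner ℂ g k := by
  have hg : g =ᵐ[haar p] fourierTrunc f 0 := by
    have h0 : eLpNorm (fun ξ => fourierTrunc f 0 ξ - g ξ) 2 (haar p) = 0 := by
      refine tendsto_nhds_unique (tendsto_const_nhds.congr fun n => ?_) hfg
      simp only [fourierTrunc_eq_zero_radius hf n]
    have h1 := (eLpNorm_eq_zero_iff ((aestronglyMeasurable_fourierTrunc f 0).sub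
      (Lp.aestronglyMeasurable g)) (by norm_num)).1 h0
    filter_upwards [h1] with ξ hξ
    exact (sub_eq_zero.1 hξ).symm
  have hmeas : ∀ n, AEStronglyMeasurable (fun x => fourierTrunc k n (-x)) (haar p) := fun n =>
    (aestronglyMeasurable_fourierTrunc k n).comp_measurePreserving
      (Measure.measurePreserving_neg (haar p))
  have hmem : ∀ᶠ n in atTop, MemLp (fun x => fourierTrunc k n (-x)) 2 (haar p) := by
    filter_upwards [hkh.eventually_lt_const ENNReal.zero_lt_top] with n hn
    have : MemLp (fun x => fourierTrunc k n (-x) - h x) 2 (haar p) :=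
      ⟨(hmeas n).sub (Lp.aestronglyMeasurable h), hn⟩
    convert! this.add (Lp.memLp h) using 1
    ext x
    simp
  classical
  -- The truncated inverse transforms are known to be in `L²` only for large `n`, where their
  -- distance to `h` is finite; the default `0` covers the other indices.
  let U : ℕ → L2 p := fun n =>
    if hn : MemLp (fun x => fourierTrunc k n (-x)) 2 (haar p) then hn.toLp _ else 0
  have hU : ∀ᶠ n in atTop, U n =ᵐ[haar p] fun x => fourierTrunc k n (-x) := by
    filter_upwards [hmem] with n hn
    simp only [U, dif_pos hn]
    exact hn.coeFn_toLp
  have hUlim : Tendsto U atTop (𝓝 h) := by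
    rw [Lp.tendsto_Lp_iff_tendsto_eLpNorm']
    refine hkh.congr' ?_
    filter_upwards [hU] with n hn
    refine eLpNorm_congr_ae ?_
    filter_upwards [hn] with x hx
    rw [Pi.sub_apply, hx]
  have hleft : Tendsto (fun n => inner ℂ f (U n)) atTop (𝓝 (inner ℂ f h)) :=
    (continuous_const.inner continuous_id).continuousAt.tendsto.comp hUlim
  have hright : Tendsto (fun n : ℕ => ∫ ξ in pball p n, inner ℂ (g ξ) (k ξ) ∂(haar p)) atTop
      (𝓝 (inner ℂ g k)) := by
    rw [L2.inner_def, ← setIntegral_univ, ← iUnion_pball]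
    exact tendsto_setIntegral_of_monotone (fun n => measurableSet_pball n)
      (fun m n hmn => pball_mono (by omega)) (L2.integrable_inner g k).integrableOn
  refine tendsto_nhds_unique hleft (hright.congr' ?_)
  filter_upwards [hU] with n hn
  have h1 : inner ℂ f (U n)
      = ∫ x in pball p (0 : ℕ), (starRingEnd ℂ) (f x) * fourierTrunc k n (-x) ∂(haar p) := by
    rw [L2.inner_def, ← setIntegral_univ]
    rw [setIntegral_eq_of_subset_of_ae_sdiff_eq_zero MeasurableSet.univ.nullMeasurableSet
      (Set.subset_univ (pball p (0 : ℕ)))]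
    · refine integral_congr_ae (ae_restrict_of_ae ?_)
      filter_upwards [hn] with x hx
      rw [RCLike.inner_apply', hx]
    · filter_upwards [hf] with x hx h
      rw [hx h.2, inner_zero_left]
  rw [h1, setIntegral_conj_mul_fourierTrunc_neg]
  refine integral_congr_ae (ae_restrict_of_ae ?_)
  filter_upwards [hg] with ξ hξ
  rw [RCLike.inner_apply', hξ]

/-- Both sides equal `m_α ⟨𝓕Φ₁, |ξ|^α 𝓕Φ₂⟩`, as the multiplier and `m_α` are real. -/
theorem IsHamiltonian.inner_comm {α mα : ℝ} {Φ₁ η₁ Φ₂ η₂ : L2 p}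
    (H₁ : IsHamiltonian α mα Φ₁ η₁) (H₂ : IsHamiltonian α mα Φ₂ η₂) :
    inner ℂ Φ₁ η₂ = inner ℂ η₁ Φ₂ := by
  obtain ⟨a0, h₁, ⟨g₁, k₁, a1, a2, a3⟩, a4⟩ := H₁
  obtain ⟨b0, h₂, ⟨g₂, k₂, b1, b2, b3⟩, b4⟩ := H₂
  rw [← pball_zero] at a0 a4 b0 b4
  -- Pairing with a function supported in `ℤ_p` makes the cut-off in `H` disappear.
  have key : ∀ {Φ h η : L2 p}, (∀ᵐ x ∂(haar p), x ∉ pball p 0 → Φ x = 0) →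
      (η =ᵐ[haar p] (pball p 0).indicator fun x => (mα : ℂ) * h x) →
      inner ℂ Φ η = mα * inner ℂ Φ h := by
    intro Φ h η h0 h1
    rw [L2.inner_def, L2.inner_def, ← integral_const_mul]
    refine integral_congr_ae ?_
    filter_upwards [h0, h1] with x hx0 hx1
    by_cases hx : x ∈ pball p 0
    · rw [hx1, Set.indicator_of_mem hx, RCLike.inner_apply', RCLike.inner_apply']
      ring
    · rw [hx0 hx]
      simp
  rw [key a0 b4, inner_eq_of_isFourier a0 a1 b3, ← inner_conj_symm η₁, key b0 a4,
    inner_eq_of_isFourier b0 b1 a3, map_mul, Complex.conj_ofReal, inner_conj_symm,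
    L2.inner_def, L2.inner_def]
  congr 1
  refine integral_congr_ae ?_
  filter_upwards [a2, b2] with ξ h1 h2
  rw [h1, h2, RCLike.inner_apply', RCLike.inner_apply', map_mul, Complex.conj_ofReal]
  ring

/-! ### Uniqueness for the Cauchy problem -/

/-- Symmetry of `H` makes `‖Ψ₁ - Ψ₂‖²` have zero derivative at positive times; continuity at `0` and
the mean value theorem carry this back to the common initial state. -/
theorem IsWaveFunction.unique {α mα : ℝ} {K : Set ℚ_[p]} {Ψ₁ Ψ₂ : ℝ → L2 p}
    (H₁ : IsWaveFunction α mα K Ψ₁) (H₂ : IsWaveFunction α mα K Ψ₂) {t : ℝ} (ht : 0 ≤ t) :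
    Ψ₁ t = Ψ₂ t := by
  have h0 : Ψ₁ 0 = Ψ₂ 0 := Lp.ext (H₁.initial.trans H₂.initial.symm)
  rcases ht.eq_or_lt with rfl | ht
  · exact h0
  have hI : ∀ {Φ₁ Φ₂ Φ₁' Φ₂' : L2 p}, IsHamiltonian α mα Φ₁ (Complex.I • Φ₁') →
      IsHamiltonian α mα Φ₂ (Complex.I • Φ₂') → inner ℂ Φ₁ Φ₂' + inner ℂ Φ₁' Φ₂ = 0 := by
    intro Φ₁ Φ₂ Φ₁' Φ₂' h₁ h₂
    have h := h₁.inner_comm h₂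
    rw [inner_smul_right, inner_smul_left, Complex.conj_I] at h
    have h' : Complex.I * (inner ℂ Φ₁ Φ₂' + inner ℂ Φ₁' Φ₂) = 0 := by linear_combination h
    exact (mul_eq_zero.1 h').resolve_left Complex.I_ne_zero
  have hcont : ContinuousOn (fun s => (inner ℂ (Ψ₁ s - Ψ₂ s) (Ψ₁ s - Ψ₂ s)).re) (Set.Icc 0 t) :=
    have hc := (H₁.continuousOn.sub H₂.continuousOn).mono (fun s (hs : s ∈ Set.Icc 0 t) => hs.1)
    Complex.continuous_re.comp_continuousOn (hc.inner hc)
  have hderiv : ∀ s ∈ Set.Ioo 0 t,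
      HasDerivAt (fun s => (inner ℂ (Ψ₁ s - Ψ₂ s) (Ψ₁ s - Ψ₂ s)).re) 0 s := by
    intro s hs
    obtain ⟨d₁, hd₁, hH₁⟩ := H₁.schrodinger s hs.1
    obtain ⟨d₂, hd₂, hH₂⟩ := H₂.schrodinger s hs.1
    have h := HasDerivAt.inner ℂ (hd₁.sub hd₂) (hd₁.sub hd₂)
    have hz : inner ℂ (Ψ₁ s - Ψ₂ s) (d₁ - d₂) + inner ℂ (d₁ - d₂) (Ψ₁ s - Ψ₂ s) = 0 := by
      simp only [inner_sub_left, inner_sub_right]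
      -- Expanding into the four pairings avoids showing that `H` is linear on its domain.
      linear_combination hI hH₁ hH₁ + hI hH₂ hH₂ - hI hH₁ hH₂ - hI hH₂ hH₁
    have h' := (Complex.reCLM.hasFDerivAt.comp_hasDerivAt s h)
    simp only [Pi.sub_apply] at h'
    rw [hz, map_zero] at h'
    exact h'
  obtain ⟨c, -, hc⟩ := exists_hasDerivAt_eq_slope _ (fun _ => 0) ht hcont hderiv
  rw [eq_comm, div_eq_zero_iff, or_iff_left (by linarith), h0, sub_self, inner_zero_left,
    Complex.zero_re, sub_zero] at hc
  rw [← sub_eq_zero, ← norm_eq_zero, ← sq_eq_zero_iff, ← inner_self_eq_norm_sq (𝕜 := ℂ)]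
  exact hc

/-! ### Superpositions of eigenfunctions -/

/-- The eigenfunctions of the Hamiltonian: `1_{ℤ_p}`, then the functions `waveletLp p m`. -/
def eigenLp (p : ℕ) [Fact p.Prime] : ℕ → L2 p
  | 0 => ballLp p 0
  | m + 1 => waveletLp p m

/-- The values of the eigenfunctions `eigenLp p i`. -/
def eigenFun (p : ℕ) [Fact p.Prime] : ℕ → ℚ_[p] → ℂ
  | 0 => ind p 0
  | m + 1 => fun x => p * ind p (-(m + 1 : ℤ)) x - ind p (-(m : ℤ)) x

/-- The eigenvalue of `eigenLp p i`. -/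
def eigenvalue (p : ℕ) (α mα : ℝ) : ℕ → ℝ
  | 0 => energyGnd p α mα
  | m + 1 => energy p α mα m

theorem eigenFun_succ (m : ℕ) (x : ℚ_[p]) :
    eigenFun p (m + 1) x = p * ind p (-(m + 1 : ℤ)) x - ind p (-(m : ℤ)) x := rfl

theorem coeFn_eigenLp (i : ℕ) : eigenLp p i =ᵐ[haar p] eigenFun p i := by
  cases i with
  | zero => exact coeFn_ballLp 0
  | succ m => exact coeFn_waveletLp m

theorem exactHamiltonian_eigenLp {α : ℝ} (hα : 0 < α) (mα : ℝ) (i : ℕ) :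
    ExactHamiltonian α mα (eigenLp p i) ((eigenvalue p α mα i : ℂ) • eigenLp p i) := by
  cases i with
  | zero => exact exactHamiltonian_ballLp_zero hα mα
  | succ m => exact exactHamiltonian_waveletLp α mα m

/-- The superposition at time `t` of the first `N` eigenfunctions with initial amplitudes `a`. -/
def evolution (p : ℕ) [Fact p.Prime] (α mα : ℝ) (a : ℕ → ℂ) (N : ℕ) (t : ℝ) : L2 p :=
  ∑ i ∈ Finset.range N, (phase (eigenvalue p α mα i) t * a i) • eigenLp p i

theorem coeFn_evolution (α mα : ℝ) (a : ℕ → ℂ) (N : ℕ) (t : ℝ) :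
    evolution p α mα a N t =ᵐ[haar p] fun x =>
      ∑ i ∈ Finset.range N, phase (eigenvalue p α mα i) t * a i * eigenFun p i x := by
  have h1 : ∀ i, (((phase (eigenvalue p α mα i) t * a i) • eigenLp p i : L2 p) : ℚ_[p] → ℂ)
      =ᵐ[haar p] fun x => phase (eigenvalue p α mα i) t * a i * eigenFun p i x := by
    intro i
    filter_upwards [Lp.coeFn_smul (phase (eigenvalue p α mα i) t * a i) (eigenLp p i),
      coeFn_eigenLp (p := p) i] with x h2 h3
    rw [h2, Pi.smul_apply, h3, smul_eq_mul]
  filter_upwards [ae_all_iff.2 h1, Lp.coeFn_fun_finsetSum (Finset.range N)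
    fun i => ((phase (eigenvalue p α mα i) t * a i) • eigenLp p i : L2 p)] with x h2 h3
  rw [evolution, h3]
  exact Finset.sum_congr rfl fun i _ => h2 i

theorem exactHamiltonian_sum {α : ℝ} (hα : 0 < α) (mα : ℝ) (b : ℕ → ℂ) (N : ℕ) :
    ExactHamiltonian α mα (∑ i ∈ Finset.range N, b i • eigenLp p i)
      (∑ i ∈ Finset.range N, b i • (eigenvalue p α mα i : ℂ) • eigenLp p i) := by
  induction N with
  | zero => simpa using (exactHamiltonian_eigenLp (p := p) hα mα 0).smul 0
  | succ N ih =>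
    rw [Finset.sum_range_succ, Finset.sum_range_succ]
    exact ih.add ((exactHamiltonian_eigenLp hα mα N).smul (b N))

theorem hasDerivAt_phase (E t : ℝ) : HasDerivAt (phase E) (-Complex.I * E * phase E t) t := by
  have h1 : HasDerivAt (fun s : ℝ => -Complex.I * E * (s : ℂ)) (-Complex.I * E) t := by
    simpa using (Complex.ofRealCLM.hasDerivAt (x := t)).const_mul (-Complex.I * E)
  have h2 := h1.cexp
  rw [mul_comm (Complex.exp _)] at h2
  exact h2

theorem isWaveFunction_evolution {α : ℝ} (hα : 0 < α) (mα : ℝ) {K : Set ℚ_[p]} {a : ℕ → ℂ}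
    {N : ℕ} (ha : ∀ x, ∑ i ∈ Finset.range N, a i * eigenFun p i x
      = K.indicator (fun _ => (((Real.sqrt ((haar p).real K))⁻¹ : ℝ) : ℂ)) x) :
    IsWaveFunction α mα K (evolution p α mα a N) := by
  have hd : ∀ t, HasDerivAt (evolution p α mα a N) (∑ i ∈ Finset.range N,
      (-Complex.I * eigenvalue p α mα i * phase (eigenvalue p α mα i) t * a i) • eigenLp p i) t :=
    fun t => HasDerivAt.fun_sum fun i _ =>
      ((hasDerivAt_phase (eigenvalue p α mα i) t).mul_const (a i)).smul_const (eigenLp p i)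
  refine ⟨?_, fun t _ => (hd t).continuousAt.continuousWithinAt, fun t _ => ⟨_, hd t, ?_⟩⟩
  · filter_upwards [coeFn_evolution (p := p) α mα a N 0] with x hx
    rw [hx, ← ha]
    refine Finset.sum_congr rfl fun i _ => ?_
    simp [phase]
  · have h := exactHamiltonian_sum (p := p) hα mα
      (fun i => phase (eigenvalue p α mα i) t * a i) N
    convert! h.isHamiltonian using 1
    rw [Finset.smul_sum]
    refine Finset.sum_congr rfl fun i _ => ?_
    rw [smul_smul, smul_smul]
    congr 1
    linear_combination (-eigenvalue p α mα i * phase (eigenvalue p α mα i) t * a i) * Complex.I_mul_I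

/-! ### Initial states -/

/-- The sum telescopes: `p^m w_m = p^{m+1} 1_{p^{m+1}ℤ_p} - p^m 1_{p^m ℤ_p}`. -/
theorem sum_pow_mul_eigenFun (N : ℕ) (x : ℚ_[p]) :
    eigenFun p 0 x + ∑ m ∈ Finset.range N, (p : ℂ) ^ m * eigenFun p (m + 1) x
      = (p : ℂ) ^ N * ind p (-(N : ℤ)) x := by
  induction N with
  | zero => simp [eigenFun]
  | succ N ih =>
    rw [Finset.sum_range_succ, ← add_assoc, ih, eigenFun_succ, pow_succ]
    push_cast
    ring

/-- The normalization constant of `1_K`. -/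
def normConst (K : Set ℚ_[p]) : ℝ := (Real.sqrt ((haar p).real K))⁻¹

theorem sq_normConst (K : Set ℚ_[p]) : normConst K ^ 2 = ((haar p).real K)⁻¹ := by
  rw [normConst, inv_pow, Real.sq_sqrt measureReal_nonneg]

/-- The sphere `{x : |x|_p = p ^ (-r)}`. -/
def psphere (p : ℕ) [Fact p.Prime] (r : ℕ) : Set ℚ_[p] := {x | ‖x‖ = (p : ℝ) ^ (-(r : ℤ))}

theorem psphere_eq (r : ℕ) : psphere p r = pball p (-(r : ℤ)) \ pball p (-(r + 1 : ℤ)) := by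
  ext x
  constructor
  · intro h
    exact ⟨(mem_pball_iff_of_norm_eq h).2 le_rfl, fun h' => by
      have := (mem_pball_iff_of_norm_eq h).1 h'
      omega⟩
  · rintro ⟨h, h'⟩
    have h0 : x ≠ 0 := by
      rintro rfl
      have := prime_real_pos p
      exact h' (by rw [mem_pball, norm_zero]; positivity)
    have hn := Padic.norm_eq_zpow_neg_valuation h0
    rw [mem_pball_iff_of_norm_eq hn] at h h'
    have : -x.valuation = -(r : ℤ) := by omega
    rwa [this] at hn

theorem measurableSet_psphere (r : ℕ) : MeasurableSet (psphere p r) := by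
  rw [psphere_eq]
  exact (measurableSet_pball _).diff (measurableSet_pball _)

theorem haar_real_psphere (r : ℕ) :
    (haar p).real (psphere p r) = ((p : ℝ) ^ r)⁻¹ * (1 - (p : ℝ)⁻¹) := by
  have hpr := prime_real_pos p
  rw [psphere_eq, measureReal_sdiff (pball_mono (by omega)) (measurableSet_pball _)
    (haar_pball_ne_top _), haar_real_pball, haar_real_pball, neg_add, zpow_add₀ hpr.ne',
    zpow_neg, zpow_natCast, zpow_neg_one]
  ring

theorem indicator_psphere (r : ℕ) (c : ℂ) (x : ℚ_[p]) :
    (psphere p r).indicator (fun _ => c) x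
      = c * (ind p (-(r : ℤ)) x - ind p (-(r + 1 : ℤ)) x) := by
  rw [psphere_eq]
  by_cases h1 : x ∈ pball p (-(r + 1 : ℤ))
  · rw [Set.indicator_of_notMem (fun h => h.2 h1), ind_of_mem h1,
      ind_of_mem (pball_mono (by omega) h1)]
    simp
  · by_cases h2 : x ∈ pball p (-(r : ℤ))
    · rw [Set.indicator_of_mem (show x ∈ _ \ _ from ⟨h2, h1⟩), ind_of_mem h2, ind_of_notMem h1]
      simp
    · rw [Set.indicator_of_notMem (fun h => h2 h.1), ind_of_notMem h2, ind_of_notMem h1]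
      simp

/-- The amplitudes of the normalized characteristic function of `p ^ R ℤ_p`. -/
def ampBall (p : ℕ) [Fact p.Prime] (R : ℕ) : ℕ → ℂ
  | 0 => normConst (pball p (-(R : ℤ))) * ((p : ℂ) ^ R)⁻¹
  | m + 1 => normConst (pball p (-(R : ℤ))) * ((p : ℂ) ^ R)⁻¹ * (p : ℂ) ^ m

/-- The amplitudes of the normalized characteristic function of a sphere. -/
def ampSphere (p : ℕ) [Fact p.Prime] (r : ℕ) : ℕ → ℂ
  | 0 => normConst (psphere p r) * coeffZero p r
  | m + 1 => normConst (psphere p r) * (coeff p r m * ((p : ℝ) ^ ((m : ℝ) / 2) : ℝ))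

theorem sum_ampBall (R : ℕ) (x : ℚ_[p]) :
    ∑ i ∈ Finset.range (R + 1), ampBall p R i * eigenFun p i x
      = (pball p (-(R : ℤ))).indicator (fun _ => (normConst (pball p (-(R : ℤ))) : ℂ)) x := by
  have hpc : (p : ℂ) ≠ 0 := by exact_mod_cast (Fact.out : p.Prime).ne_zero
  have h := sum_pow_mul_eigenFun R x
  have h1 : ∑ i ∈ Finset.range (R + 1), ampBall p R i * eigenFun p i x
      = normConst (pball p (-(R : ℤ))) * ((p : ℂ) ^ R)⁻¹ *
        (eigenFun p 0 x + ∑ m ∈ Finset.range R, (p : ℂ) ^ m * eigenFun p (m + 1) x) := by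
    rw [Finset.sum_range_succ', mul_add, Finset.mul_sum, add_comm]
    simp only [ampBall, mul_assoc]
  rw [h1, h, mul_assoc, inv_mul_cancel_left₀ (pow_ne_zero _ hpc)]
  by_cases hx : x ∈ pball p (-(R : ℤ)) <;> simp [ind, hx]

/-- The half-integral powers recombine, so below level `r` the amplitudes of a sphere are
proportional to those of a ball. -/
theorem coeff_mul_of_lt {r m : ℕ} (h : m < r) :
    coeff p r m * (p : ℝ) ^ ((m : ℝ) / 2) = coeffZero p r * (p : ℝ) ^ m := by
  have hpr := prime_real_pos p
  rw [coeff, if_neg (by omega), if_neg (by omega), coeffZero]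
  have : (p : ℝ) ^ ((m : ℝ) / 2 - r) * (p : ℝ) ^ ((m : ℝ) / 2)
      = (p : ℝ) ^ (-(r : ℝ)) * (p : ℝ) ^ m := by
    rw [← Real.rpow_natCast (p : ℝ) m, ← Real.rpow_add hpr, ← Real.rpow_add hpr]
    ring_nf
  linear_combination (1 - (p : ℝ)⁻¹) * this

theorem coeff_mul_self (r : ℕ) :
    coeff p r r * (p : ℝ) ^ ((r : ℝ) / 2) = -(p : ℝ)⁻¹ := by
  have hpr := prime_real_pos p
  rw [coeff, if_neg (by omega), if_pos rfl, neg_mul, ← Real.rpow_add hpr, ← Real.rpow_neg_one]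
  ring_nf

theorem coeffZero_eq (r : ℕ) : coeffZero p r = ((p : ℝ) ^ r)⁻¹ * (1 - (p : ℝ)⁻¹) := by
  rw [coeffZero, Real.rpow_neg (prime_real_pos p).le, Real.rpow_natCast]

/-- Up to normalization, the terms below level `r` telescope to `(1 - p⁻¹) 1_{p^r ℤ_p}`. The last
one, `-p⁻¹ w_r = p⁻¹ 1_{p^r ℤ_p} - 1_{p^{r+1}ℤ_p}`, completes this to the indicator of the sphere.
The range `r + 2` counts the ground state and `m = 0, …, r`. -/
theorem sum_ampSphere (r : ℕ) (x : ℚ_[p]) :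
    ∑ i ∈ Finset.range (r + 2), ampSphere p r i * eigenFun p i x
      = (psphere p r).indicator (fun _ => (normConst (psphere p r) : ℂ)) x := by
  have hpc : (p : ℂ) ≠ 0 := by exact_mod_cast (Fact.out : p.Prime).ne_zero
  have h := sum_pow_mul_eigenFun r x
  have h1 : ∑ i ∈ Finset.range (r + 1), ampSphere p r i * eigenFun p i x
      = normConst (psphere p r) * coeffZero p r *
        (eigenFun p 0 x + ∑ m ∈ Finset.range r, (p : ℂ) ^ m * eigenFun p (m + 1) x) := by
    rw [Finset.sum_range_succ', mul_add, Finset.mul_sum, add_comm]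
    congr 1
    refine Finset.sum_congr rfl fun m hm => ?_
    rw [ampSphere, ← Complex.ofReal_mul, coeff_mul_of_lt (Finset.mem_range.1 hm)]
    push_cast
    ring
  rw [Finset.sum_range_succ, h1, h, ampSphere, ← Complex.ofReal_mul (coeff p r r),
    coeff_mul_self, eigenFun_succ,
    indicator_psphere, coeffZero_eq]
  push_cast
  field_simp
  ring

/-! ### Values on the cells -/

theorem eigenFun_zero_of_mem {x : ℚ_[p]} (h : x ∈ pball p 0) : eigenFun p 0 x = 1 :=
  ind_of_mem h

theorem eigenFun_succ_of_mem {m R : ℕ} (hm : m < R) {x : ℚ_[p]} (h : x ∈ pball p (-(R : ℤ))) :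
    eigenFun p (m + 1) x = p - 1 := by
  rw [eigenFun_succ, ind_of_mem (pball_mono (by omega) h), ind_of_mem (pball_mono (by omega) h),
    mul_one]

theorem eigenFun_succ_of_mem_psphere {m r : ℕ} {x : ℚ_[p]} (h : x ∈ psphere p r) :
    eigenFun p (m + 1) x = if m < r then (p : ℂ) - 1 else if m = r then -1 else 0 := by
  rw [eigenFun_succ, ind_of_norm_eq h, ind_of_norm_eq h]
  split_ifs <;> first | omega | simp

theorem transitionProb_eq_of_const {K : Set ℚ_[p]} (hK : MeasurableSet K) {Ψ : ℝ → L2 p} {t : ℝ}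
    {F : ℚ_[p] → ℂ} (hF : Ψ t =ᵐ[haar p] F) {v : ℂ} (hv : ∀ x ∈ K, F x = v) :
    transitionProb K Ψ t = (haar p).real K * ‖v‖ ^ 2 := by
  rw [transitionProb, setIntegral_congr_ae (g := fun _ => ‖v‖ ^ 2) hK]
  · simp
  · filter_upwards [hF] with x hx h
    rw [hx, hv x h]

/-- The argument without `k` has norm `p^{m+1-r}`: at most `1` if `m < r`, giving `p - 1` trivial
terms, and exactly `p` if `m = r`. These are the values of `w_m` on the sphere of radius `p^{-r}`.
-/
theorem sum_chi_zpow_mul {m r : ℕ} (hm : m ≤ r) {u : ℚ_[p]} (hu : ‖u‖ = 1) :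
    ∑ k ∈ Finset.Ico 1 p, chi ((p : ℚ_[p]) ^ (-(m : ℤ) - 1 + (r : ℤ)) * (k : ℚ_[p]) * u)
      = if m < r then (p : ℂ) - 1 else if m = r then -1 else 0 := by
  have h1 : ∀ k : ℕ, (p : ℚ_[p]) ^ (-(m : ℤ) - 1 + (r : ℤ)) * (k : ℚ_[p]) * u
      = (k : ℚ_[p]) * ((p : ℚ_[p]) ^ (-(m : ℤ) - 1 + (r : ℤ)) * u) := fun k => by ring
  simp only [h1]
  have hn : ‖(p : ℚ_[p]) ^ (-(m : ℤ) - 1 + (r : ℤ)) * u‖ = (p : ℝ) ^ (m + 1 - r : ℤ) := by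
    rw [norm_mul, hu, mul_one, norm_prime_zpow]
    congr 1
    ring
  rcases hm.lt_or_eq with h | rfl
  · rw [if_pos h]
    have h2 : chi ((p : ℚ_[p]) ^ (-(m : ℤ) - 1 + (r : ℤ)) * u) = 1 := chi_eq_one (by
      rw [hn]
      exact zpow_le_one_of_nonpos₀ (one_lt_prime_real p).le (by omega))
    simp [chi_natCast_mul, h2, Nat.cast_sub (Fact.out : p.Prime).one_lt.le]
  · rw [if_neg (lt_irrefl _), if_pos rfl, sum_chi_mul]
    rw [hn]
    simp

/-! ### Solutions attached to the vertices and their transition probabilities. -/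

theorem cell_gamma (R₀ : ℕ) : cell p (Vertex.gamma (R₀ := R₀)) = pball p (-(R₀ : ℤ)) := by
  ext x
  rw [mem_pball]
  rfl

theorem cell_sphere {R₀ : ℕ} (r : Fin R₀) : cell p (Vertex.sphere r) = psphere p r := rfl

/-- The solution of the Cauchy problem for the initial state attached to a vertex. -/
def vertexSolution (p : ℕ) [Fact p.Prime] (α mα : ℝ) {R₀ : ℕ} : Vertex R₀ → ℝ → L2 p
  | .sphere r => evolution p α mα (ampSphere p r) (r + 2)
  | .gamma => evolution p α mα (ampBall p R₀) (R₀ + 1)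

theorem isWaveFunction_vertexSolution {α : ℝ} (hα : 0 < α) (mα : ℝ) {R₀ : ℕ} (v : Vertex R₀) :
    IsWaveFunction α mα (cell p v) (vertexSolution p α mα v) := by
  cases v with
  | sphere r =>
    rw [cell_sphere]
    exact isWaveFunction_evolution hα mα (sum_ampSphere r)
  | gamma =>
    rw [cell_gamma]
    exact isWaveFunction_evolution hα mα (sum_ampBall R₀)

theorem transitionProb_gamma_gamma (α mα : ℝ) (R₀ : ℕ) (t : ℝ) :
    transitionProb (pball p (-(R₀ : ℤ))) (evolution p α mα (ampBall p R₀) (R₀ + 1)) t =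
      (p : ℝ) ^ (-2 * (R₀ : ℝ)) * ‖phase (energyGnd p α mα) t + ((p : ℂ) - 1) *
        ∑ m ∈ Finset.range R₀, (p : ℂ) ^ m * phase (energy p α mα m) t‖ ^ 2 := by
  have hpr := prime_real_pos p
  rw [transitionProb_eq_of_const (measurableSet_pball _) (coeFn_evolution α mα _ _ t)
    (v := normConst (pball p (-(R₀ : ℤ))) * ((p : ℂ) ^ R₀)⁻¹ *
      (phase (energyGnd p α mα) t + ((p : ℂ) - 1) *
        ∑ m ∈ Finset.range R₀, (p : ℂ) ^ m * phase (energy p α mα m) t))]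
  · rw [norm_mul, norm_mul, mul_pow, mul_pow, Complex.norm_real, Real.norm_eq_abs, sq_abs,
      sq_normConst, haar_real_pball, norm_inv, norm_pow, Complex.norm_natCast, ← mul_assoc,
      ← mul_assoc, mul_inv_cancel₀ (by positivity), one_mul]
    congr 1
    rw [neg_mul, Real.rpow_neg hpr.le, inv_pow, ← pow_mul, ← Real.rpow_natCast]
    push_cast
    ring_nf
  · intro x hx
    rw [Finset.sum_range_succ', eigenFun_zero_of_mem (pball_mono (by omega) hx), mul_add,
      Finset.mul_sum, Finset.mul_sum, add_comm]
    congr 1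
    · simp only [eigenvalue, ampBall]
      ring
    · refine Finset.sum_congr rfl fun m hm => ?_
      rw [eigenFun_succ_of_mem (Finset.mem_range.1 hm) hx, eigenvalue, ampBall]
      ring

/-- The integrand on the right does not depend on `u` once the sum over `k` is carried out, so the
integral contributes the factor `1 - p⁻¹`, the measure of the unit sphere. -/
theorem transitionProb_sphere_gamma (α mα : ℝ) {R₀ r : ℕ} (hr : r < R₀) (t : ℝ) :
    transitionProb (psphere p r) (evolution p α mα (ampBall p R₀) (R₀ + 1)) t =
      (p : ℝ) ^ (-(r : ℝ) - (R₀ : ℝ)) * ∫ u in {u : ℚ_[p] | ‖u‖ = 1},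
        ‖phase (energyGnd p α mα) t + ∑ k ∈ Finset.Ico 1 p,
          ∑ m ∈ Finset.range (min r (R₀ - 1) + 1), (p : ℂ) ^ m * phase (energy p α mα m) t *
            chi ((p : ℚ_[p]) ^ (-(m : ℤ) - 1 + (r : ℤ)) * (k : ℚ_[p]) * u)‖ ^ 2 ∂(haar p) := by
  have hpr := prime_real_pos p
  set v : ℂ := phase (energyGnd p α mα) t + ∑ m ∈ Finset.range (r + 1),
    (p : ℂ) ^ m * phase (energy p α mα m) t *
      if m < r then (p : ℂ) - 1 else if m = r then -1 else 0 with hv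
  have hint : ∫ u in {u : ℚ_[p] | ‖u‖ = 1},
        ‖phase (energyGnd p α mα) t + ∑ k ∈ Finset.Ico 1 p,
          ∑ m ∈ Finset.range (min r (R₀ - 1) + 1), (p : ℂ) ^ m * phase (energy p α mα m) t *
            chi ((p : ℚ_[p]) ^ (-(m : ℤ) - 1 + (r : ℤ)) * (k : ℚ_[p]) * u)‖ ^ 2 ∂(haar p)
      = (1 - (p : ℝ)⁻¹) * ‖v‖ ^ 2 := by
    have hs : {u : ℚ_[p] | ‖u‖ = 1} = psphere p 0 := by simp [psphere]
    rw [hs, setIntegral_congr_fun (g := fun _ => ‖v‖ ^ 2) (measurableSet_psphere 0)]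
    · simp [haar_real_psphere]
    · intro u hu
      rw [← hs] at hu
      simp only
      rw [Finset.sum_comm, show min r (R₀ - 1) = r by omega, hv]
      congr 3
      refine Finset.sum_congr rfl fun m hm => ?_
      rw [← Finset.mul_sum, sum_chi_zpow_mul (by have := Finset.mem_range.1 hm; omega) hu]
  rw [hint, transitionProb_eq_of_const (measurableSet_psphere _) (coeFn_evolution α mα _ _ t)
    (v := normConst (pball p (-(R₀ : ℤ))) * ((p : ℂ) ^ R₀)⁻¹ * v)]
  · rw [norm_mul, norm_mul, mul_pow, mul_pow, Complex.norm_real, Real.norm_eq_abs, sq_abs,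
      sq_normConst, haar_real_pball, haar_real_psphere, norm_inv, norm_pow, Complex.norm_natCast,
      Real.rpow_sub hpr, Real.rpow_neg hpr.le, Real.rpow_natCast, Real.rpow_natCast, zpow_neg,
      zpow_natCast, inv_inv]
    field_simp
  · intro x hx
    have hx0 : x ∈ pball p 0 := (mem_pball_iff_of_norm_eq hx).2 (by omega)
    rw [Finset.sum_range_succ', eigenFun_zero_of_mem hx0, hv, mul_add, Finset.mul_sum, add_comm]
    congr 1
    · simp only [eigenvalue, ampBall]
      ring
    · symm
      -- The functions `w_m` with `m > r` vanish on this sphere, which cuts the sum at `m = r`.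
      refine (Finset.sum_subset_zero_on_sdiff (Finset.range_mono (by omega : r + 1 ≤ R₀))
        (fun m hm => ?_) fun m hm => ?_)
      · have h := (Finset.mem_sdiff.1 hm).2
        rw [Finset.mem_range] at h
        rw [eigenFun_succ_of_mem_psphere hx, if_neg (by omega), if_neg (by omega), mul_zero]
      · rw [eigenFun_succ_of_mem_psphere hx, eigenvalue, ampBall]
        ring

/-- Only levels `m ≤ r < R₀` occur, and each `w_m` equals `p - 1` on the ball; this factor is the
number of terms in the sum over `k`. -/
theorem transitionProb_gamma_sphere (α mα : ℝ) {R₀ r : ℕ} (hr : r < R₀) (t : ℝ) :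
    transitionProb (pball p (-(R₀ : ℤ))) (evolution p α mα (ampSphere p r) (r + 2)) t =
      (p : ℝ) ^ ((r : ℝ) - (R₀ : ℝ)) * (1 - (p : ℝ)⁻¹)⁻¹ *
        ‖(coeffZero p r : ℂ) * phase (energyGnd p α mα) t + ∑ _k ∈ Finset.Ico 1 p,
          ∑ m ∈ Finset.range (min r (R₀ - 1) + 1), (coeff p r m : ℂ) *
            phase (energy p α mα m) t * (((p : ℝ) ^ ((m : ℝ) / 2) : ℝ) : ℂ)‖ ^ 2 := by
  have hpr := prime_real_pos p
  rw [transitionProb_eq_of_const (measurableSet_pball _) (coeFn_evolution α mα _ _ t)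
    (v := normConst (psphere p r) * ((coeffZero p r : ℂ) * phase (energyGnd p α mα) t +
      ∑ _k ∈ Finset.Ico 1 p, ∑ m ∈ Finset.range (min r (R₀ - 1) + 1), (coeff p r m : ℂ) *
        phase (energy p α mα m) t * (((p : ℝ) ^ ((m : ℝ) / 2) : ℝ) : ℂ)))]
  · rw [norm_mul, mul_pow, Complex.norm_real, Real.norm_eq_abs, sq_abs, sq_normConst,
      haar_real_pball, haar_real_psphere, Real.rpow_sub hpr, Real.rpow_natCast,
      Real.rpow_natCast, zpow_neg, zpow_natCast, mul_inv, inv_inv]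
    ring
  · intro x hx
    rw [Finset.sum_range_succ', eigenFun_zero_of_mem (pball_mono (by omega) hx), mul_add,
      add_comm, show min r (R₀ - 1) = r by omega, Finset.sum_const, Nat.card_Ico, nsmul_eq_mul,
      Nat.cast_sub (Fact.out : p.Prime).one_lt.le, Finset.mul_sum, Finset.mul_sum]
    congr 1
    · simp only [eigenvalue, ampSphere]
      ring
    · refine Finset.sum_congr rfl fun m hm => ?_
      rw [eigenFun_succ_of_mem (by have := Finset.mem_range.1 hm; omega) hx, eigenvalue, ampSphere]
      push_cast
      ring

theorem transitionProb_congr {K : Set ℚ_[p]} {Ψ₁ Ψ₂ : ℝ → L2 p} {t : ℝ} (h : Ψ₁ t = Ψ₂ t) :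
    transitionProb K Ψ₁ t = transitionProb K Ψ₂ t := by
  rw [transitionProb, transitionProb, h]

end

end PadicWalk

theorem mainTheorem5 (p : ℕ) [Fact p.Prime] (hp : 3 ≤ p) (R₀ : ℕ) (hR₀ : 3 ≤ R₀)
    (α mα : ℝ) (hα : 0 < α) (hmα : 0 < mα) :
    (∀ v : PadicWalk.Vertex R₀, ∃ Ψ : ℝ → PadicWalk.L2 p,
      PadicWalk.IsWaveFunction α mα (PadicWalk.cell p v) Ψ ∧
      ∀ Ψ₁ : ℝ → PadicWalk.L2 p, PadicWalk.IsWaveFunction α mα (PadicWalk.cell p v) Ψ₁ →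
        ∀ t : ℝ, 0 ≤ t → Ψ₁ t = Ψ t) ∧
    ∀ Ψ : PadicWalk.Vertex R₀ → ℝ → PadicWalk.L2 p,
      (∀ v, PadicWalk.IsWaveFunction α mα (PadicWalk.cell p v) (Ψ v)) →
      ∀ t : ℝ, 0 ≤ t →
        PadicWalk.transitionProb (PadicWalk.cell p (PadicWalk.Vertex.gamma (R₀ := R₀)))
            (Ψ PadicWalk.Vertex.gamma) t =
          (p : ℝ) ^ (-2 * (R₀ : ℝ)) *
            ‖PadicWalk.phase (PadicWalk.energyGnd p α mα) t +
              ((p : ℂ) - 1) * ∑ m ∈ Finset.range R₀,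
                (p : ℂ) ^ m * PadicWalk.phase (PadicWalk.energy p α mα m) t‖ ^ 2 ∧
        ∀ r : Fin R₀,
          PadicWalk.transitionProb (PadicWalk.cell p (PadicWalk.Vertex.sphere r))
              (Ψ PadicWalk.Vertex.gamma) t =
            (p : ℝ) ^ (-((r : ℕ) : ℝ) - (R₀ : ℝ)) *
              ∫ u in {u : ℚ_[p] | ‖u‖ = 1},
                ‖PadicWalk.phase (PadicWalk.energyGnd p α mα) t +
                  ∑ k ∈ Finset.Ico 1 p, ∑ m ∈ Finset.range (min (r : ℕ) (R₀ - 1) + 1),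
                    (p : ℂ) ^ m * PadicWalk.phase (PadicWalk.energy p α mα m) t *
                      PadicWalk.chi
                        ((p : ℚ_[p]) ^ (-(m : ℤ) - 1 + ((r : ℕ) : ℤ)) * (k : ℚ_[p]) * u)‖ ^ 2
                ∂(PadicWalk.haar p) ∧
          PadicWalk.transitionProb (PadicWalk.cell p (PadicWalk.Vertex.gamma (R₀ := R₀)))
              (Ψ (PadicWalk.Vertex.sphere r)) t =
            (p : ℝ) ^ (((r : ℕ) : ℝ) - (R₀ : ℝ)) * (1 - (p : ℝ)⁻¹)⁻¹ *
              ‖(PadicWalk.coeffZero p r : ℂ) *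
                  PadicWalk.phase (PadicWalk.energyGnd p α mα) t +
                ∑ _k ∈ Finset.Ico 1 p, ∑ m ∈ Finset.range (min (r : ℕ) (R₀ - 1) + 1),
                  (PadicWalk.coeff p r m : ℂ) *
                    PadicWalk.phase (PadicWalk.energy p α mα m) t *
                    (((p : ℝ) ^ ((m : ℝ) / 2) : ℝ) : ℂ)‖ ^ 2 := by
  refine ⟨fun v => ⟨PadicWalk.vertexSolution p α mα v,
    PadicWalk.isWaveFunction_vertexSolution hα mα v, fun Ψ₁ h₁ t ht =>
      h₁.unique (PadicWalk.isWaveFunction_vertexSolution hα mα v) ht⟩, fun Ψ hΨ t ht => ?_⟩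
  have h := fun v => (hΨ v).unique (PadicWalk.isWaveFunction_vertexSolution hα mα v) ht
  rw [PadicWalk.transitionProb_congr (h _), PadicWalk.cell_gamma]
  refine ⟨PadicWalk.transitionProb_gamma_gamma α mα R₀ t, fun r => ?_⟩
  rw [PadicWalk.transitionProb_congr (h _), PadicWalk.transitionProb_congr (h _),
    PadicWalk.cell_sphere]
  exact ⟨PadicWalk.transitionProb_sphere_gamma α mα r.2 t,
    PadicWalk.transitionProb_gamma_sphere α mα r.2 t⟩
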